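/- Let $R$ be an associative ring with identity which is semi-primary: it has a two-sided nilpotent ideal $N$ (its radical) such that $R/N$ is semisimple. Modules are left $R$-modules. A module $M$ is Gorenstein projective if $M\cong\operatorname{Im}(P_0\to P^0)$ for some exact sequence $\cdots\to P_1\to P_0\to P^0\to P^1\to\cdots$ of projective modules that stays exact under $\operatorname{Hom}_R(-,Q)$ for every projective module $Q$; $\mathrm{Gpd}_R(M)\in\{0,1,\dots,\infty\}$ is the least $n$ for which there is an exact sequence $0\to G_n\to\cdots\to G_0\to M\to 0$ with all $G_i$ Gorenstein projective ($\infty$ if there is none). Gorenstein injective modules (exact sequences of injective modules that stay exact under $\operatorname{Hom}_R(E,-)$ for every injective module $E$) and $\mathrm{Gid}_R(M)$ (exact sequences $0\to M\to G^0\to\cdots\to G^n\to 0$ with all $G^i$ Gorenstein injective) are defined dually. Let $\mathrm{l.Ggldim}(R)=\sup\{\mathrm{Gpd}_R(M) : M \text{ a left } R\text{-module}\}$ be the left Gorenstein global dimension of $R$. Then $$\mathrm{l.Ggldim}(R)=\sup_{M}\mathrm{Gid}_R(M)=\mathrm{Gpd}_R(R/N)=\mathrm{Gid}_R(R/N)=\sup_C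 \mathrm{Gpd}_R(C)=\sup_C\mathrm{Gid}_R(C),$$ where $M$ ranges over all left $R$-modules and $C$ over all simple left $R$-modules. If moreover $R$ is not quasi-Frobenius (that is, not both left and right Noetherian and left and right self-injective), then $$\mathrm{l.Ggldim}(R)=1+\mathrm{Gpd}_R(N).$$ -/

import Mathlib

universe u

/-- An exact two-sided infinite sequence `⋯ → X (-1) → X 0 → X 1 → ⋯` of left `R`-modules. -/
structure ExactSeq (R : Type u) [Ring R] where
  /-- the modules -/
  X : ℤ → ModuleCat.{u} R
  /-- the maps -/
  d : ∀ i : ℤ, X i →ₗ[R] X (i + 1)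
  exact : ∀ i : ℤ, Function.Exact (d i) (d (i + 1))

/-- A left `R`-module `M` is Gorenstein projective if it is isomorphic to an image in an exact
sequence of projective modules that stays exact under `Hom_R(-, Q)` for all projective `Q`. -/
def IsGorensteinProjective (R : Type u) [Ring R] (M : Type u) [AddCommGroup M] [Module R M] :
    Prop :=
  ∃ P : ExactSeq R,
    (∀ i, Module.Projective R (P.X i)) ∧
    (∀ Q : ModuleCat.{u} R, Module.Projective R Q → ∀ i : ℤ,
      Function.Exact
        (fun f : P.X (i + 1 + 1) →ₗ[R] Q => f ∘ₗ P.d (i + 1))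
        (fun f : P.X (i + 1) →ₗ[R] Q => f ∘ₗ P.d i)) ∧
    Nonempty (M ≃ₗ[R] LinearMap.range (P.d 0))

/-- A left `R`-module `M` is Gorenstein injective if it is isomorphic to an image in an exact
sequence of injective modules that stays exact under `Hom_R(E, -)` for all injective `E`. -/
def IsGorensteinInjective (R : Type u) [Ring R] (M : Type u) [AddCommGroup M] [Module R M] :
    Prop :=
  ∃ I : ExactSeq R,
    (∀ i, Module.Injective R (I.X i)) ∧
    (∀ E : ModuleCat.{u} R, Module.Injective R E → ∀ i : ℤ,
      Function.Exact
        (fun f : E →ₗ[R] I.X i => I.d i ∘ₗ f)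
        (fun f : E →ₗ[R] I.X (i + 1) => I.d (i + 1) ∘ₗ f)) ∧
    Nonempty (M ≃ₗ[R] LinearMap.range (I.d 0))

/-- There is an exact sequence `0 → G n → ⋯ → G 1 → G 0 → M → 0` with all `G i` Gorenstein
projective (written as an infinite sequence that vanishes beyond `n`). -/
def HasGorensteinProjectiveResolution (R : Type u) [Ring R] (M : Type u) [AddCommGroup M]
    [Module R M] (n : ℕ) : Prop :=
  ∃ (G : ℕ → ModuleCat.{u} R) (d : ∀ i : ℕ, G (i + 1) →ₗ[R] G i) (ε : G 0 →ₗ[R] M),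
    (∀ i, IsGorensteinProjective R (G i)) ∧
    (∀ i, n < i → Subsingleton (G i)) ∧
    Function.Surjective ε ∧
    Function.Exact (d 0) ε ∧
    ∀ i, Function.Exact (d (i + 1)) (d i)

/-- There is an exact sequence `0 → M → G 0 → G 1 → ⋯ → G n → 0` with all `G i` Gorenstein
injective (written as an infinite sequence that vanishes beyond `n`). -/
def HasGorensteinInjectiveResolution (R : Type u) [Ring R] (M : Type u) [AddCommGroup M]
    [Module R M] (n : ℕ) : Prop :=
  ∃ (G : ℕ → ModuleCat.{u} R) (d : ∀ i : ℕ, G i →ₗ[R] G (i + 1)) (η : M →ₗ[R] G 0),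
    (∀ i, IsGorensteinInjective R (G i)) ∧
    (∀ i, n < i → Subsingleton (G i)) ∧
    Function.Injective η ∧
    Function.Exact η (d 0) ∧
    ∀ i, Function.Exact (d i) (d (i + 1))

/-- The Gorenstein projective dimension `Gpd_R(M) ∈ {0, 1, 2, …, ∞}`. -/
noncomputable def Gpd (R : Type u) [Ring R] (M : Type u) [AddCommGroup M] [Module R M] : ℕ∞ :=
  ⨅ (n : ℕ) (_ : HasGorensteinProjectiveResolution R M n), (n : ℕ∞)

/-- The Gorenstein injective dimension `Gid_R(M) ∈ {0, 1, 2, …, ∞}`. -/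
noncomputable def Gid (R : Type u) [Ring R] (M : Type u) [AddCommGroup M] [Module R M] : ℕ∞ :=
  ⨅ (n : ℕ) (_ : HasGorensteinInjectiveResolution R M n), (n : ℕ∞)

/-- The left Gorenstein global dimension of `R`: the supremum of `Gpd_R(M)` over all left
`R`-modules `M`. -/
noncomputable def leftGgldim (R : Type u) [Ring R] : ℕ∞ :=
  ⨆ M : ModuleCat.{u} R, Gpd R M

/-- `R` is quasi-Frobenius: Noetherian and self-injective, on both sides. -/
def IsQuasiFrobenius (R : Type u) [Ring R] : Prop :=
  IsNoetherian R R ∧ IsNoetherian Rᵐᵒᵖ R ∧ Module.Injective R R ∧ Module.Injective Rᵐᵒᵖ R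

/-!
Gorenstein injective modules are Gorenstein projective objects of the opposite category, so the
homological part is carried out once, in an abelian category with enough projectives and enough
injectives, and applied to left `R`-modules and to their opposite category.

In the abelian category, Gorenstein projective objects are described coinductively (`IsGP`): they
form the largest class of objects `M` such that `Ext^i(M, Q) = 0` for all `i > 0` and all projective
`Q`, and such that `M` embeds into a projective object with cokernel again in the class. From this
description, closure under extensions, retracts and coproducts (`IsGP.extension`, `IsGP.retract`,
`IsGP.sigma`) follows by diagram chases with short exact sequences, and it passes to the objects of
Gorenstein projective dimension at most `n` (`GPDim`).

The left global Gorenstein projective and injective dimensions agree because having Gorenstein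
projective dimension at most `n` for all objects is equivalent to the self-dual condition that
projectives have injective dimension at most `n` and injectives have projective dimension at most
`n` (`forall_gpDim_iff`, `forall_gpDim_op_iff`). One direction embeds an injective object into an
object of projective dimension at most `n`; for the other, the `n`-th syzygies of an injective
resolution of `M` form a projective coresolution of the `n`-th syzygy of `M`.

Over a semiprimary ring, every module is an iterated extension of semisimple modules
(`forall_of_isSemisimpleModule`). A semisimple module is a direct sum of simple modules and also a
retract of their product, and a simple module is a retract of `R ⧸ N`. By the closure properties,
bounds on the dimensions of `R ⧸ N`, or of the simple modules, hold for all modules.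

Finally, `N` is a first syzygy of `R ⧸ N`, so its dimension is one less than that of `R ⧸ N`, unless
the latter is zero. In that case projective and injective left modules coincide, and `R` is
quasi-Frobenius (`isQuasiFrobenius_of_projective_iff_injective`): it is left Noetherian by the
argument of Bass and Papp, hence left Artinian, and the annihilator conditions relating left and
right ideals give that it is right Noetherian and right self-injective.
-/

open CategoryTheory Limits Opposite Abelian

universe v w

/-! ### Short exact sequences in abelian categories -/

section Ses

variable {C : Type w} [Category.{v} C] [Abelian C]

/-- There is a short exact sequence `0 → A → B → D → 0`. -/
def Ses (A B D : C) : Prop :=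
  ∃ (f : A ⟶ B) (g : B ⟶ D) (w : f ≫ g = 0), (ShortComplex.mk f g w).ShortExact

lemma Ses.op {A B D : C} (h : Ses A B D) : Ses (op D) (op B) (op A) := by
  obtain ⟨f, g, w, h⟩ := h
  exact ⟨g.op, f.op, by rw [← op_comp, w, op_zero], h.op⟩

lemma Ses.of_op {A B D : C} (h : Ses (Opposite.op D) (Opposite.op B) (Opposite.op A)) :
    Ses A B D := by
  obtain ⟨f, g, w, h⟩ := h
  exact ⟨g.unop, f.unop, by rw [← unop_comp, w, unop_zero], h.unop⟩

lemma Ses.of_mono {A B : C} (f : A ⟶ B) [Mono f] : Ses A B (cokernel f) :=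
  ⟨f, cokernel.π f, cokernel.condition f,
    { exact := ShortComplex.exact_of_g_is_cokernel _ (cokernelIsCokernel f) }⟩

lemma Ses.of_epi {A B : C} (f : A ⟶ B) [Epi f] : Ses (kernel f) A B :=
  ⟨kernel.ι f, f, kernel.condition f,
    { exact := ShortComplex.exact_of_f_is_kernel _ (kernelIsKernel f) }⟩

lemma Ses.of_iso {A A' B B' D D' : C} (h : Ses A B D) (e₁ : A ≅ A') (e₂ : B ≅ B') (e₃ : D ≅ D') :
    Ses A' B' D' := by
  obtain ⟨f, g, w, h⟩ := h
  have w' : (e₁.inv ≫ f ≫ e₂.hom) ≫ e₂.inv ≫ g ≫ e₃.hom = 0 := by simp [reassoc_of% w]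
  exact ⟨_, _, w', ShortComplex.shortExact_of_iso (S₂ := ShortComplex.mk _ _ w')
    (ShortComplex.isoMk e₁ e₂ e₃) h⟩

/-- Pushing a short exact sequence out along an arbitrary map of its left end. -/
lemma shortExact_pushout {A B U Y : C} {f : A ⟶ B} {g : B ⟶ U} {w : f ≫ g = 0}
    (h : (ShortComplex.mk f g w).ShortExact) (f' : A ⟶ Y) :
    ∃ w', (ShortComplex.mk (pushout.inr f f')
      (pushout.desc g 0 (by simpa using w)) w').ShortExact := by
  have := h.mono_f
  have := h.epi_g
  dsimp at this
  refine ⟨pushout.inr_desc (f := f) (g := f') g (0 : Y ⟶ U) (by simpa using w), ?_⟩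
  have : Epi (pushout.desc (f := f) (g := f') g (0 : Y ⟶ U) (by simpa using w)) :=
    epi_of_epi_fac (pushout.inl_desc _ _ _)
  refine { exact := ShortComplex.exact_of_g_is_cokernel _ ?_, mono_f := by dsimp; infer_instance }
  refine CokernelCofork.IsColimit.ofπ' _ _ fun {T} k hk => ?_
  have hk' : f ≫ pushout.inl f f' ≫ k = 0 := by
    rw [pushout.condition_assoc]; dsimp at hk; rw [hk, comp_zero]
  refine ⟨h.gIsCokernel.desc (CokernelCofork.ofπ _ hk'), ?_⟩
  have : g ≫ h.gIsCokernel.desc (CokernelCofork.ofπ _ hk') = pushout.inl f f' ≫ k :=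
    h.gIsCokernel.fac (CokernelCofork.ofπ _ hk') WalkingParallelPair.one
  dsimp at hk
  apply pushout.hom_ext
  · exact (pushout.inl_desc_assoc _ _ _ _).trans this
  · exact (pushout.inr_desc_assoc _ _ _ _).trans (zero_comp.trans hk.symm)

/-- The two short exact sequences through the pushout of two monomorphisms. -/
lemma Ses.pushout {A B U Y V : C} (h₁ : Ses A B U) (h₂ : Ses A Y V) :
    ∃ W, Ses Y W U ∧ Ses B W V := by
  obtain ⟨f, g, w, h⟩ := h₁
  obtain ⟨f', g', w', h'⟩ := h₂
  exact ⟨_, ⟨_, _, shortExact_pushout h f'⟩,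
    Ses.of_iso ⟨_, _, shortExact_pushout h' f⟩ (.refl _) (pushoutSymmetry f' f) (.refl _)⟩

/-- The two short exact sequences through the pullback of two epimorphisms. -/
lemma Ses.pullback {A B D K P : C} (h₁ : Ses A B D) (h₂ : Ses K P D) :
    ∃ W, Ses A W P ∧ Ses K W B := by
  obtain ⟨W, h, h'⟩ := Ses.pushout h₁.op h₂.op
  exact ⟨W.unop, h.of_op, h'.of_op⟩

/-- For `A ⊆ B ⊆ D`, the short exact sequence `0 → B/A → D/A → D/B → 0`. -/
lemma Ses.comp {A B U D V : C} (h₁ : Ses A B U) (h₂ : Ses B D V) :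
    ∃ W, Ses A D W ∧ Ses U W V := by
  obtain ⟨f, g, w, h⟩ := h₁
  obtain ⟨f', g', w', h'⟩ := h₂
  have := h.mono_f
  have := h.epi_g
  have := h'.mono_f
  dsimp at *
  refine ⟨_, ⟨f ≫ f', pushout.inl f' g, ?_, ?_⟩, ⟨_, _, shortExact_pushout h' g⟩⟩
  · rw [Category.assoc, pushout.condition, reassoc_of% w, zero_comp]
  refine { exact := ShortComplex.exact_of_g_is_cokernel _ ?_,
           mono_f := by dsimp; infer_instance, epi_g := by dsimp; infer_instance }
  refine CokernelCofork.IsColimit.ofπ' _ _ fun {T} k hk => ?_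
  dsimp at hk
  have hk' : f ≫ f' ≫ k = 0 := by simpa using hk
  have e : g ≫ h.gIsCokernel.desc (CokernelCofork.ofπ _ hk') = f' ≫ k :=
    h.gIsCokernel.fac (CokernelCofork.ofπ _ hk') WalkingParallelPair.one
  exact ⟨pushout.desc k _ e.symm, pushout.inl_desc _ _ _⟩

/-- For epimorphisms `P → B → D`, the kernels form a short exact sequence. -/
lemma Ses.comp' {K P B A D : C} (h₁ : Ses K P B) (h₂ : Ses A B D) :
    ∃ W, Ses W P D ∧ Ses K W A := by
  obtain ⟨W, h, h'⟩ := Ses.comp h₂.op h₁.op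
  exact ⟨W.unop, h.of_op, h'.of_op⟩

/-- A split short exact sequence can be reversed. -/
lemma CategoryTheory.ShortComplex.Splitting.ses_swap {S : ShortComplex C} (s : S.Splitting) :
    Ses S.X₃ S.X₂ S.X₁ := by
  let t : (ShortComplex.mk s.s s.r s.s_r).Splitting :=
    { r := S.g, s := S.f, f_r := s.s_g, s_g := s.f_r,
      id := by rw [add_comm]; exact s.id }
  exact ⟨_, _, _, t.shortExact⟩

lemma Ses.swap_of_projective {A B D : C} (h : Ses A B D) [Projective D] : Ses D B A := by
  obtain ⟨f, g, w, h⟩ := h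
  exact (h.splittingOfProjective (S := ShortComplex.mk f g w)).ses_swap

lemma Ses.projective {A B D : C} (h : Ses A B D) (hA : Projective A) (hD : Projective D) :
    Projective B := by
  obtain ⟨f, g, w, h⟩ := h
  let s : (ShortComplex.mk f g w).Splitting := h.splittingOfProjective
  exact Projective.of_iso (s.isoBinaryBiproduct).symm inferInstance

/-- The horseshoe lemma: projective presentations of the ends of a short exact sequence combine to
one of the middle term. -/
lemma Ses.horseshoe {A B D K P L Q : C} (h : Ses A B D) (hA : Ses K P A) (hD : Ses L Q D)
    (hP : Projective P) (hQ : Projective Q) :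
    ∃ M T, Projective T ∧ Ses M T B ∧ Ses K M L := by
  obtain ⟨X, h₁, h₂⟩ := h.pullback hD
  obtain ⟨Y, h₃, h₄⟩ := h₁.swap_of_projective.pullback hA
  obtain ⟨W, h₅, h₆⟩ := h₄.comp' h₂
  exact ⟨W, Y, h₃.projective hQ hP, h₅, h₆⟩

end Ses

/-! ### Vanishing of `Ext` into projective objects -/

section ExtVanish

variable {C : Type w} [Category.{v} C] [Abelian C]

/-- `Ext^i(M, Q) = 0` for all projective `Q` and all `i > n`. -/
def ExtVanish (n : ℕ) (M : C) : Prop :=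
  letI := HasExt.standard C
  ∀ (Q : C), Projective Q → ∀ i, n < i → Subsingleton (Ext M Q i)

lemma ExtVanish.mono {m n : ℕ} (h : m ≤ n) {M : C} (hM : ExtVanish m M) : ExtVanish n M :=
  fun Q hQ i hi => hM Q hQ i (by omega)

lemma extVanish_of_projective {P : C} (hP : Projective P) : ExtVanish 0 P := by
  let := HasExt.standard C
  intro Q _ i hi
  obtain ⟨i, rfl⟩ := Nat.exists_eq_succ_of_ne_zero hi.ne'
  exact Ext.subsingleton_of_projective ..

lemma ExtVanish.retract {n : ℕ} {M B : C} (r : Retract M B) (h : ExtVanish n B) :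
    ExtVanish n M := by
  let := HasExt.standard C
  refine fun Q hQ i hi => subsingleton_of_forall_eq 0 fun x => ?_
  have := h Q hQ i hi
  rw [← x.mk₀_id_comp, ← r.retract, ← Ext.mk₀_comp_mk₀, Ext.comp_assoc_of_second_deg_zero,
    Subsingleton.elim ((Ext.mk₀ r.r).comp x (zero_add i)) 0, Ext.comp_zero]

lemma ExtVanish.mid {n : ℕ} {A B D : C} (h : Ses A B D) (hA : ExtVanish n A)
    (hD : ExtVanish n D) : ExtVanish n B := by
  let := HasExt.standard C
  obtain ⟨f, g, w, h⟩ := h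
  refine fun Q hQ i hi => subsingleton_of_forall_eq 0 fun x => ?_
  have := hA Q hQ i hi
  have := hD Q hQ i hi
  obtain ⟨y, rfl⟩ := Ext.contravariant_sequence_exact₂ h _ x
    (Subsingleton.elim (α := Ext A Q i) _ _)
  rw [Subsingleton.elim (α := Ext D Q i) y 0, Ext.comp_zero]

lemma ExtVanish.left {n : ℕ} {A B D : C} (h : Ses A B D) (hB : ExtVanish n B)
    (hD : ExtVanish (n + 1) D) : ExtVanish n A := by
  let := HasExt.standard C
  obtain ⟨f, g, w, h⟩ := h
  refine fun Q hQ i hi => subsingleton_of_forall_eq 0 fun x => ?_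
  have := hB Q hQ i hi
  have := hD Q hQ (1 + i) (by omega)
  obtain ⟨y, rfl⟩ := Ext.contravariant_sequence_exact₁ h _ x rfl
    (Subsingleton.elim (α := Ext D Q (1 + i)) _ _)
  rw [Subsingleton.elim (α := Ext B Q i) y 0, Ext.comp_zero]

lemma ExtVanish.right {n : ℕ} {A B D : C} (h : Ses A B D) (hA : ExtVanish n A)
    (hB : ExtVanish (n + 1) B) : ExtVanish (n + 1) D := by
  let := HasExt.standard C
  obtain ⟨f, g, w, h⟩ := h
  refine fun Q hQ i hi => subsingleton_of_forall_eq 0 fun x => ?_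
  obtain ⟨i, rfl⟩ : ∃ j, i = 1 + j := ⟨i - 1, by omega⟩
  have := hA Q hQ i (by omega)
  have := hB Q hQ (1 + i) (by omega)
  obtain ⟨y, rfl⟩ := Ext.contravariant_sequence_exact₃ h _ x
    (Subsingleton.elim (α := Ext B Q (1 + i)) _ _) rfl
  rw [Subsingleton.elim (α := Ext A Q i) y 0, Ext.comp_zero]

/-- If `Ext¹(D, Q) = 0` then maps to `Q` extend along monomorphisms with cokernel `D`. -/
lemma ExtVanish.exists_extension {A B D : C} {f : A ⟶ B} {g : B ⟶ D} {w : f ≫ g = 0}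
    (h : (ShortComplex.mk f g w).ShortExact) (hD : ExtVanish 0 D) {Q : C} (hQ : Projective Q)
    (k : A ⟶ Q) : ∃ l : B ⟶ Q, f ≫ l = k := by
  let := HasExt.standard C
  have := hD Q hQ 1 (by omega)
  obtain ⟨y, hy⟩ := Ext.contravariant_sequence_exact₁ h _ (Ext.mk₀ k) (add_zero 1)
    (Subsingleton.elim (α := Ext D Q 1) _ _)
  obtain ⟨l, rfl⟩ := Ext.homEquiv₀.symm.surjective y
  exact ⟨l, Ext.homEquiv₀.symm.injective (by simpa using hy)⟩

/-- The `Ext¹` of a quotient of a projective vanishes as soon as maps extend from the kernel. -/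
lemma subsingleton_ext_one_of_extension [HasExt.{max v w} C] {A B D : C} {f : A ⟶ B} {g : B ⟶ D}
    {w : f ≫ g = 0} (h : (ShortComplex.mk f g w).ShortExact) (hB : Projective B) {Q : C}
    (H : ∀ k : A ⟶ Q, ∃ l : B ⟶ Q, f ≫ l = k) : Subsingleton (Ext D Q 1) := by
  refine subsingleton_of_forall_eq 0 fun x => ?_
  obtain ⟨y, rfl⟩ := Ext.contravariant_sequence_exact₃ h _ x
    (Ext.eq_zero_of_projective _) (add_zero 1)
  obtain ⟨k, rfl⟩ := Ext.homEquiv₀.symm.surjective y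
  obtain ⟨l, rfl⟩ := H k
  have := h.extClass_comp_assoc (Ext.mk₀ l) (h := add_zero 1)
  simpa using this

/-- Coinductive criterion for the vanishing of `Ext^i(-, Q)`, `i > 0`: a class of objects closed
under some choice of syzygies, all of whose `Ext¹(-, Q)` vanish. -/
lemma extVanish_of_forall_extension (X : C → Prop)
    (hX : ∀ M, X M → ∃ (K P : C) (f : K ⟶ P) (g : P ⟶ M) (w : f ≫ g = 0),
      (ShortComplex.mk f g w).ShortExact ∧ Projective P ∧ X K ∧
      ∀ Q, Projective Q → ∀ k : K ⟶ Q, ∃ l : P ⟶ Q, f ≫ l = k) {M : C} (hM : X M) :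
    ExtVanish 0 M := by
  let := HasExt.standard C
  intro Q hQ i hi
  obtain ⟨i, rfl⟩ : ∃ j, i = 1 + j := ⟨i - 1, by omega⟩
  induction i generalizing M with
  | zero =>
    obtain ⟨K, P, f, g, w, h, hP, hK, H⟩ := hX M hM
    exact subsingleton_ext_one_of_extension h hP (H Q hQ)
  | succ i ih =>
    obtain ⟨K, P, f, g, w, h, hP, hK, H⟩ := hX M hM
    have := ih hK (by omega)
    refine subsingleton_of_forall_eq 0 fun x => ?_
    obtain ⟨y, rfl⟩ := Ext.contravariant_sequence_exact₃ h _ x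
      ((Ext.subsingleton_of_projective P Q (1 + i)).elim _ _) (n₀ := 1 + i) (by omega)
    rw [this.elim y 0, Ext.comp_zero]

lemma Ses.swap_of_extVanish {A B D : C} (h : Ses A B D) (hA : Projective A)
    (hD : ExtVanish 0 D) : Ses D B A := by
  obtain ⟨f, g, w, h⟩ := h
  obtain ⟨r, hr⟩ := hD.exists_extension h hA (𝟙 A)
  exact (ShortComplex.Splitting.ofExactOfRetraction (ShortComplex.mk f g w) h.exact r hr
    h.epi_g).ses_swap

lemma extVanish_of_injectiveDimension {n : ℕ}
    (H : ∀ Q : C, Projective Q → HasInjectiveDimensionLT Q (n + 1)) (M : C) : ExtVanish n M := by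
  let := HasExt.standard C
  intro Q hQ i hi
  have := H Q hQ
  exact HasInjectiveDimensionLT.subsingleton Q (n + 1) i hi M

lemma injectiveDimension_of_extVanish {n : ℕ} (H : ∀ M : C, ExtVanish n M) (Q : C)
    (hQ : Projective Q) : HasInjectiveDimensionLT Q (n + 1) := by
  let := HasExt.standard C
  rw [hasInjectiveDimensionLT_iff]
  intro i hi Y e
  have := H Y Q hQ i (by omega)
  exact Subsingleton.elim _ _

end ExtVanish

section Coproduct

variable {C : Type w} [Category.{v} C] [Abelian C] {J : Type*} [HasCoproductsOfShape J C]

omit [Abelian C] in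
lemma projective_sigma {P : J → C} (h : ∀ j, Projective (P j)) : Projective (∐ P) where
  factors f e _ := ⟨Sigma.desc fun j => Projective.factorThru (Sigma.ι P j ≫ f) e, by
    apply Limits.Sigma.hom_ext; simp⟩

lemma sigma_map_comp_eq_zero {A B D : J → C} {f : ∀ j, A j ⟶ B j}
    {g : ∀ j, B j ⟶ D j} (w : ∀ j, f j ≫ g j = 0) :
    Limits.Sigma.map f ≫ Limits.Sigma.map g = 0 := by
  apply Sigma.hom_ext
  simp [reassoc_of% w]

/-- In an abelian category with enough injectives, coproducts of short exact sequences are short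
exact: a monomorphism from `∐ A` into an injective object extends to `∐ B` componentwise. -/
lemma shortExact_sigma [EnoughInjectives C] {A B D : J → C} (f : ∀ j, A j ⟶ B j)
    (g : ∀ j, B j ⟶ D j) (w : ∀ j, f j ≫ g j = 0)
    (h : ∀ j, (ShortComplex.mk (f j) (g j) (w j)).ShortExact) :
    (ShortComplex.mk _ _ (sigma_map_comp_eq_zero w)).ShortExact := by
  have hf (j) : Mono (f j) := (h j).mono_f
  have hg (j) : Epi (g j) := (h j).epi_g
  have hm : Mono (Limits.Sigma.map f) := by
    have : Limits.Sigma.map f ≫ Sigma.desc (fun j =>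
        Injective.factorThru (Sigma.ι A j ≫ Injective.ι _) (f j)) = Injective.ι (∐ A) := by
      apply Sigma.hom_ext
      simp
    exact mono_of_mono_fac this
  refine { exact := ShortComplex.exact_of_g_is_cokernel _ ?_, epi_g := by dsimp; infer_instance }
  refine CokernelCofork.IsColimit.ofπ' _ _ fun {T} k hk => ?_
  dsimp at hk
  have hk' (j) : f j ≫ Sigma.ι B j ≫ k = 0 := by
    have := congr(Sigma.ι A j ≫ $hk)
    simpa using this
  have e (j) : g j ≫ (h j).gIsCokernel.desc (CokernelCofork.ofπ _ (hk' j)) = Sigma.ι B j ≫ k :=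
    (h j).gIsCokernel.fac (CokernelCofork.ofπ _ (hk' j)) WalkingParallelPair.one
  refine ⟨Sigma.desc fun j => (h j).gIsCokernel.desc (CokernelCofork.ofπ _ (hk' j)), ?_⟩
  dsimp
  apply Sigma.hom_ext
  intro j
  rw [Sigma.ι_map_assoc, Sigma.ι_desc, e]

lemma Ses.sigma [EnoughInjectives C] {A B D : J → C} (h : ∀ j, Ses (A j) (B j) (D j)) :
    Ses (∐ A) (∐ B) (∐ D) := by
  choose f g w h using h
  exact ⟨_, _, _, shortExact_sigma f g w h⟩

lemma ExtVanish.sigma [EnoughProjectives C] [EnoughInjectives C] {M : J → C}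
    (h : ∀ j, ExtVanish 0 (M j)) : ExtVanish 0 (∐ M) := by
  let := HasExt.standard C
  intro Q hQ i hi
  obtain ⟨i, rfl⟩ : ∃ j, i = 1 + j := ⟨i - 1, by omega⟩
  have hP (M : J → C) : Projective (∐ fun j => Projective.over (M j)) :=
    projective_sigma fun j => inferInstance
  have hs (M : J → C) := shortExact_sigma (fun j => kernel.ι (Projective.π (M j)))
    (fun j => Projective.π (M j)) (fun j => kernel.condition _)
    (fun j => { exact := ShortComplex.exact_of_f_is_kernel _ (kernelIsKernel _) })
  induction i generalizing M with
  | zero =>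
    have hs := hs M
    refine subsingleton_ext_one_of_extension hs (hP M) fun k => ?_
    have hl (j) := (h j).exists_extension (f := kernel.ι (Projective.π (M j)))
      (g := Projective.π (M j)) (w := kernel.condition _)
      { exact := ShortComplex.exact_of_f_is_kernel _ (kernelIsKernel _) } hQ
      (Sigma.ι (fun j => kernel (Projective.π (M j))) j ≫ k)
    choose l hl using hl
    refine ⟨Sigma.desc l, ?_⟩
    apply Sigma.hom_ext
    simp [hl]
  | succ i ih =>
    have hs' := hs M
    have := hP M
    have := ih (M := fun j => kernel (Projective.π (M j)))
      (fun j => (extVanish_of_projective inferInstance).left (.of_epi (Projective.π (M j)))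
        ((h j).mono (by omega))) (by omega)
    refine subsingleton_of_forall_eq 0 fun x => ?_
    obtain ⟨y, rfl⟩ := Ext.contravariant_sequence_exact₃ hs' _ x
      ((Ext.subsingleton_of_projective (∐ fun j => Projective.over (M j)) Q (1 + i)).elim _ _)
      (n₀ := 1 + i) (by omega)
    rw [this.elim y 0, Ext.comp_zero]

end Coproduct

/-! ### Gorenstein projective objects and dimension -/

section GP

variable {C : Type w} [Category.{v} C] [Abelian C]

/-- Gorenstein projective objects, described coinductively: the largest class of objects `M` with
`Ext^i(M, Q) = 0` for all projective `Q` and `i > 0`, each of which embeds into a projective object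
with cokernel in the class. -/
def IsGP (G : C) : Prop :=
  ∃ X : C → Prop, X G ∧ ∀ M, X M → ExtVanish 0 M ∧ ∃ P M', Projective P ∧ Ses M P M' ∧ X M'

lemma IsGP.extVanish {G : C} (h : IsGP G) : ExtVanish 0 G := by
  obtain ⟨X, hG, hX⟩ := h
  exact (hX G hG).1

lemma IsGP.exists_ses {G : C} (h : IsGP G) : ∃ P G', Projective P ∧ Ses G P G' ∧ IsGP G' := by
  obtain ⟨X, hG, hX⟩ := h
  obtain ⟨P, G', hP, hs, hG'⟩ := (hX G hG).2
  exact ⟨P, G', hP, hs, X, hG', hX⟩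

lemma IsGP.of_ses {K P G : C} (h : Ses K P G) (hP : Projective P) (hG : IsGP G) : IsGP K := by
  refine ⟨fun M => IsGP M ∨ M = K, .inr rfl, ?_⟩
  rintro M (hM | rfl)
  · obtain ⟨P, G', hP, hs, hG'⟩ := hM.exists_ses
    exact ⟨hM.extVanish, P, G', hP, hs, .inl hG'⟩
  · exact ⟨(extVanish_of_projective hP).left h (hG.extVanish.mono (by omega)), P, G, hP, h, .inl hG⟩

lemma isGP_of_projective {P : C} (hP : Projective P) : IsGP P := by
  refine ⟨Projective, hP, fun M hM =>
    ⟨extVanish_of_projective hM, M, _, hM, .of_mono (𝟙 M), ?_⟩⟩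
  exact (isZero_cokernel_of_epi (𝟙 M)).projective

/-- Gorenstein projective objects are closed under extensions. -/
lemma IsGP.extension {A B D : C} (h : Ses A B D) (hA : IsGP A) (hD : IsGP D) : IsGP B := by
  refine ⟨fun M => ∃ A D, Ses A M D ∧ IsGP A ∧ IsGP D, ⟨A, D, h, hA, hD⟩, ?_⟩
  rintro M ⟨A, D, h, hA, hD⟩
  refine ⟨hA.extVanish.mid h hD.extVanish, ?_⟩
  obtain ⟨P, K, hP, h₁, hK⟩ := hA.exists_ses
  obtain ⟨Q, L, hQ, h₂, hL⟩ := hD.exists_ses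
  obtain ⟨X, h₃, h₄⟩ := h.pushout h₁
  -- the pushout of `M` along `A → P` is an extension of `D` by a projective, hence splits
  obtain ⟨Y, h₅, h₆⟩ := (h₃.swap_of_extVanish hP hD.extVanish).pushout h₂
  obtain ⟨W, h₇, h₈⟩ := h₄.comp h₆
  exact ⟨Y, W, h₅.projective hQ hP, h₇, K, L, h₈, hK, hL⟩

lemma IsGP.of_iso {G G' : C} (e : G ≅ G') (h : IsGP G) : IsGP G' := by
  refine ⟨fun M => Nonempty (G ≅ M) ∨ IsGP M, .inl ⟨e⟩, ?_⟩
  rintro M (⟨⟨e⟩⟩ | hM)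
  · obtain ⟨P, K, hP, h₁, hK⟩ := h.exists_ses
    exact ⟨h.extVanish.retract e.symm.retract, P, K, hP, h₁.of_iso e (.refl _) (.refl _), .inr hK⟩
  · obtain ⟨P, K, hP, h₁, hK⟩ := hM.exists_ses
    exact ⟨hM.extVanish, P, K, hP, h₁, .inr hK⟩

/-- Gorenstein projective objects are closed under retracts. -/
lemma IsGP.retract {M B : C} (r : Retract M B) (hB : IsGP B) : IsGP M := by
  refine ⟨fun M => ∃ B, Nonempty (Retract M B) ∧ IsGP B, ⟨B, ⟨r⟩, hB⟩, ?_⟩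
  rintro M ⟨B, ⟨r⟩, hB⟩
  refine ⟨hB.extVanish.retract r, ?_⟩
  obtain ⟨P, L, hP, hs, hL⟩ := hB.exists_ses
  obtain ⟨j, p, w, hs⟩ := hs
  have : Mono j := hs.mono_f
  have : Mono r.i := mono_of_mono_fac r.retract
  refine ⟨P, cokernel (r.i ≫ j), hP, .of_mono _, ?_⟩
  -- `P / M` is a retract of the pushout of `B → P` along the idempotent of `B` with kernel `M`
  let e : B ⟶ B := 𝟙 B - r.r ≫ r.i
  have hY : IsGP (pushout j e) := .extension ⟨_, _, shortExact_pushout hs e⟩ hB hL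
  refine ⟨_, ⟨{
    i := cokernel.desc _ (pushout.inl j e) ?_
    r := pushout.desc (cokernel.π _) (j ≫ cokernel.π _) ?_
    retract := ?_ }⟩, hY⟩
  · simp [e, pushout.condition]
  · have := cokernel.condition (r.i ≫ j)
    simp only [Category.assoc] at this
    simp [e, this]
  · ext
    rw [cokernel.π_desc_assoc, pushout.inl_desc, Category.comp_id]

lemma IsGP.sigma {J : Type*} [HasCoproductsOfShape J C] [EnoughProjectives C] [EnoughInjectives C]
    {M : J → C} (h : ∀ j, IsGP (M j)) : IsGP (∐ M) := by
  refine ⟨fun N => ∃ M : J → C, N = ∐ M ∧ ∀ j, IsGP (M j), ⟨M, rfl, h⟩, ?_⟩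
  rintro _ ⟨M, rfl, h⟩
  refine ⟨.sigma fun j => (h j).extVanish, ?_⟩
  choose P K hP hs hK using fun j => (h j).exists_ses
  exact ⟨∐ P, ∐ K, projective_sigma hP, .sigma hs, K, rfl, hK⟩

/-- `GPDim n M`: the Gorenstein projective dimension of `M` is at most `n`, witnessed by a
resolution `0 → G → P_{n-1} → ⋯ → P₀ → M → 0` with `P_i` projective and `G` Gorenstein
projective. -/
def GPDim : ℕ → C → Prop
  | 0, M => IsGP M
  | n + 1, M => ∃ K P, Projective P ∧ Ses K P M ∧ GPDim n K

lemma GPDim.of_iso {n : ℕ} {M M' : C} (e : M ≅ M') (h : GPDim n M) : GPDim n M' := by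
  cases n with
  | zero => exact IsGP.of_iso e h
  | succ n =>
    obtain ⟨K, P, hP, hs, hK⟩ := h
    exact ⟨K, P, hP, hs.of_iso (.refl _) (.refl _) e, hK⟩

lemma GPDim.extVanish {n : ℕ} {M : C} (h : GPDim n M) : ExtVanish n M := by
  induction n generalizing M with
  | zero => exact IsGP.extVanish h
  | succ n ih =>
    obtain ⟨K, P, hP, hs, hK⟩ := h
    exact (ih hK).right hs ((extVanish_of_projective hP).mono (by omega))

variable [EnoughProjectives C]

lemma GPDim.succ {n : ℕ} {M : C} (h : GPDim n M) : GPDim (n + 1) M := by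
  induction n generalizing M with
  | zero => exact ⟨_, _, inferInstance, .of_epi (Projective.π M),
      IsGP.of_ses (.of_epi (Projective.π M)) inferInstance h⟩
  | succ n ih =>
    obtain ⟨K, P, hP, hs, hK⟩ := h
    exact ⟨K, P, hP, hs, ih hK⟩

lemma GPDim.mono {m n : ℕ} (hmn : m ≤ n) {M : C} (h : GPDim m M) : GPDim n M := by
  induction hmn with
  | refl => exact h
  | step _ ih => exact ih.succ

omit [EnoughProjectives C] in
lemma GPDim.extension {n : ℕ} {A B D : C} (h : Ses A B D) (hA : GPDim n A) (hD : GPDim n D) :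
    GPDim n B := by
  induction n generalizing A B D with
  | zero => exact IsGP.extension h hA hD
  | succ n ih =>
    obtain ⟨K, P, hP, hs, hK⟩ := hA
    obtain ⟨L, Q, hQ, hs', hL⟩ := hD
    obtain ⟨M, T, hT, h₁, h₂⟩ := h.horseshoe hs hs' hP hQ
    exact ⟨M, T, hT, h₁, ih h₂ hK hL⟩

/-- In a resolution by Gorenstein projectives, the first term may be replaced by a projective. -/
lemma GPDim.of_ses {n : ℕ} {K G M : C} (h : Ses K G M) (hG : IsGP G) (hK : GPDim n K) :
    GPDim (n + 1) M := by
  obtain ⟨W, h₁, h₂⟩ := (Ses.of_epi (Projective.π G)).comp' h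
  exact ⟨W, _, inferInstance, h₁, GPDim.extension h₂ (GPDim.mono (Nat.zero_le n)
    (IsGP.of_ses (.of_epi (Projective.π G)) inferInstance hG)) hK⟩

/-- Schanuel's argument: two first syzygies of `M` are stably isomorphic, so closure under retracts
transfers the dimension from one to the other. -/
lemma GPDim.syzygy_of_retract {n : ℕ}
    (hr : ∀ {M B : C}, Retract M B → GPDim n B → GPDim n M) {K P M : C} (h : Ses K P M)
    (hP : Projective P) (hM : GPDim (n + 1) M) : GPDim n K := by
  obtain ⟨K', P', hP', h', hK'⟩ := hM
  obtain ⟨W, h₁, h₂⟩ := h'.pullback h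
  obtain ⟨f, g, w, h₂⟩ := h₂
  let s : (ShortComplex.mk f g w).Splitting := h₂.splittingOfProjective
  exact hr { i := f, r := s.r, retract := s.f_r }
    (.extension h₁ hK' (GPDim.mono (Nat.zero_le n) (isGP_of_projective hP)))

lemma GPDim.retract {n : ℕ} {M B : C} (r : Retract M B) (hB : GPDim n B) : GPDim n M := by
  induction n generalizing M B with
  | zero => exact IsGP.retract r hB
  | succ n ih =>
    -- a presentation of `B` of which the presentation `π M` of `M` is a retract
    let p := Projective.π M
    let q : Projective.over M ⊞ Projective.over B ⟶ B := biprod.desc (p ≫ r.i) (Projective.π B)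
    have hq : Epi q := epi_of_epi_fac (biprod.inr_desc (p ≫ r.i) (Projective.π B))
    have hK : GPDim n (kernel q) := GPDim.syzygy_of_retract ih (.of_epi q) inferInstance hB
    refine ⟨kernel p, _, inferInstance, .of_epi p, ih (B := kernel q) ?_ hK⟩
    exact
      { i := kernel.map p q biprod.inl r.i (by simp [q])
        r := kernel.map q p
          (biprod.desc (𝟙 _) (Projective.factorThru (Projective.π B ≫ r.r) p)) r.r (by
            ext <;> simp [q, p])
        retract := by
          ext
          simp }

/-- All first syzygies of an object of Gorenstein projective dimension at most `n + 1` have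
dimension at most `n`. -/
lemma GPDim.syzygy {n : ℕ} {K P M : C} (h : Ses K P M) (hP : Projective P)
    (hM : GPDim (n + 1) M) : GPDim n K :=
  GPDim.syzygy_of_retract GPDim.retract h hP hM

lemma GPDim.sigma {J : Type*} [HasCoproductsOfShape J C] [EnoughInjectives C] {n : ℕ}
    {M : J → C} (h : ∀ j, GPDim n (M j)) : GPDim n (∐ M) := by
  induction n generalizing M with
  | zero => exact IsGP.sigma h
  | succ n ih =>
    choose K P hP hs hK using h
    exact ⟨∐ K, ∐ P, projective_sigma hP, .sigma hs, ih hK⟩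

omit [EnoughProjectives C] in
/-- An object of Gorenstein projective dimension at most `n` embeds into an object of projective
dimension at most `n` with Gorenstein projective cokernel. -/
lemma GPDim.exists_ses {n : ℕ} {M : C} (h : GPDim n M) :
    ∃ H G, HasProjectiveDimensionLT H (n + 1) ∧ IsGP G ∧ Ses M H G := by
  induction n generalizing M with
  | zero =>
    obtain ⟨P, G, hP, hs, hG⟩ := IsGP.exists_ses h
    exact ⟨P, G, inferInstance, hG, hs⟩
  | succ n ih =>
    obtain ⟨K, P, hP, hs, hK⟩ := h
    obtain ⟨H, G, hH, hG, h₁⟩ := ih hK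
    obtain ⟨X, h₂, h₃⟩ := hs.pushout h₁
    obtain ⟨Q, L, hQ, h₄, hL⟩ := ((isGP_of_projective hP).extension h₃ hG).exists_ses
    obtain ⟨Y, h₅, h₆⟩ := h₂.comp h₄
    refine ⟨Y, L, ?_, hL, h₆⟩
    obtain ⟨f, g, w, h₅⟩ := h₅
    have := hasProjectiveDimensionLT_of_ge Q 1 (n + 1 + 1) (by omega)
    exact h₅.hasProjectiveDimensionLT_X₃ (n + 1) hH this

/-- `Syzygy n M K`: the object `K` is an `n`-th syzygy of `M`. -/
def Syzygy : ℕ → C → C → Prop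
  | 0, M, K => K = M
  | n + 1, M, K => ∃ L P, Projective P ∧ Ses L P M ∧ Syzygy n L K

lemma exists_syzygy (n : ℕ) (M : C) : ∃ K, Syzygy n M K := by
  induction n generalizing M with
  | zero => exact ⟨M, rfl⟩
  | succ n ih =>
    obtain ⟨K, hK⟩ := ih (kernel (Projective.π M))
    exact ⟨K, _, _, inferInstance, .of_epi (Projective.π M), hK⟩

omit [EnoughProjectives C] in
lemma Syzygy.gpDim {n : ℕ} {M K : C} (h : Syzygy n M K) (hK : IsGP K) : GPDim n M := by
  induction n generalizing M with
  | zero => obtain rfl := h; exact hK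
  | succ n ih =>
    obtain ⟨L, P, hP, hs, h⟩ := h
    exact ⟨L, P, hP, hs, ih h⟩

omit [EnoughProjectives C] in
lemma Syzygy.extVanish {n k : ℕ} {M K : C} (h : Syzygy n M K) (hM : ExtVanish (k + n) M) :
    ExtVanish k K := by
  induction n generalizing M with
  | zero => obtain rfl := h; exact hM
  | succ n ih =>
    obtain ⟨L, P, hP, hs, h⟩ := h
    exact ih h (((extVanish_of_projective hP).mono (by omega)).left hs hM)

omit [EnoughProjectives C] in
lemma Syzygy.projective {n : ℕ} {M K : C} (h : Syzygy n M K)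
    (hM : HasProjectiveDimensionLT M (n + 1)) : Projective K := by
  induction n generalizing M with
  | zero => obtain rfl := h; exact projective_iff_hasProjectiveDimensionLT_one.2 hM
  | succ n ih =>
    obtain ⟨L, P, hP, ⟨f, g, w, hs⟩, h⟩ := h
    exact ih h ((hs.hasProjectiveDimensionLT_X₃_iff n hP).1 hM)

/-- The iterated horseshoe lemma. -/
lemma Syzygy.exists_ses {n : ℕ} {A B D K : C} (h : Ses A B D) (hK : Syzygy n A K) :
    ∃ L K', Ses K L K' ∧ Syzygy n B L ∧ Syzygy n D K' := by
  induction n generalizing A B D with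
  | zero => obtain rfl := hK; exact ⟨B, D, h, rfl, rfl⟩
  | succ n ih =>
    obtain ⟨L, P, hP, hs, hK⟩ := hK
    obtain ⟨M, T, hT, h₁, h₂⟩ := h.horseshoe hs (.of_epi (Projective.π D)) hP inferInstance
    obtain ⟨L', K', h₃, h₄, h₅⟩ := ih h₂ hK
    exact ⟨L', K', h₃, ⟨M, T, hT, h₁, h₄⟩, _, _, inferInstance, .of_epi (Projective.π D), h₅⟩

/-- All projective objects have injective dimension at most `n` and all injective objects have
projective dimension at most `n`. -/
def FiniteDims (C : Type w) [Category.{v} C] [Abelian C] (n : ℕ) : Prop :=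
  (∀ Q : C, Projective Q → HasInjectiveDimensionLT Q (n + 1)) ∧
    ∀ I : C, Injective I → HasProjectiveDimensionLT I (n + 1)

/-- All objects have Gorenstein projective dimension at most `n` if and only if projectives have
injective dimension at most `n` and injectives have projective dimension at most `n`; the latter
condition is self-dual. -/
lemma forall_gpDim_iff [EnoughInjectives C] {n : ℕ} :
    (∀ M : C, GPDim n M) ↔ FiniteDims C n := by
  refine ⟨fun h => ⟨injectiveDimension_of_extVanish fun M => (h M).extVanish, fun I hI => ?_⟩, ?_⟩
  -- an injective `I` embeds into some `H` of projective dimension at most `n`, as a retract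
  · obtain ⟨H, G, hH, hG, f, g, w, hs⟩ := (h I).exists_ses
    have := hs.mono_f
    dsimp at this
    exact Retract.hasProjectiveDimensionLT
      { i := f, r := Injective.factorThru (𝟙 I) f, retract := by simp } _
  · rintro ⟨h₁, h₂⟩ M
    obtain ⟨K, hK⟩ := exists_syzygy n M
    refine hK.gpDim ⟨fun K => ∃ M, Syzygy n M K, ⟨M, hK⟩, ?_⟩
    rintro K ⟨M, hK⟩
    refine ⟨hK.extVanish ((extVanish_of_injectiveDimension h₁ M).mono (by omega)), ?_⟩
    -- the `n`-th syzygy `L` of an injective object containing `M` is projective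
    obtain ⟨L, K', h₃, h₄, h₅⟩ := Syzygy.exists_ses (.of_mono (Injective.ι M)) hK
    exact ⟨L, K', h₄.projective (h₂ _ inferInstance), h₃, _, h₅⟩

end GP

section Duality

variable {C : Type w} [Category.{v} C] [Abelian C]

lemma hasInjectiveDimensionLT_op_iff [EnoughProjectives C] {X : C} {n : ℕ} :
    HasInjectiveDimensionLT (op X) (n + 1) ↔ HasProjectiveDimensionLT X (n + 1) := by
  induction n generalizing X with
  | zero =>
    rw [← injective_iff_hasInjectiveDimensionLT_one, ← projective_iff_hasProjectiveDimensionLT_one,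
      Injective.projective_iff_injective_op]
  | succ n ih =>
    obtain ⟨f, g, w, hs⟩ := Ses.of_epi (Projective.π X)
    rw [hs.hasProjectiveDimensionLT_X₃_iff n inferInstance, ← ih]
    exact (hs.op.hasInjectiveDimensionLT_X₃_iff n
      (inferInstanceAs (Injective (op (Projective.over X))))).symm

lemma hasProjectiveDimensionLT_op_iff [EnoughInjectives C] {X : C} {n : ℕ} :
    HasProjectiveDimensionLT (op X) (n + 1) ↔ HasInjectiveDimensionLT X (n + 1) := by
  induction n generalizing X with
  | zero =>
    rw [← injective_iff_hasInjectiveDimensionLT_one, ← projective_iff_hasProjectiveDimensionLT_one,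
      Injective.injective_iff_projective_op]
  | succ n ih =>
    obtain ⟨f, g, w, hs⟩ := Ses.of_mono (Injective.ι X)
    rw [← hs.hasInjectiveDimensionLT_X₃_iff n inferInstance, ← ih]
    exact hs.op.hasProjectiveDimensionLT_X₃_iff n
      (inferInstanceAs (Projective (op (Injective.under X))))

lemma finiteDims_op_iff [EnoughProjectives C] [EnoughInjectives C] {n : ℕ} :
    FiniteDims Cᵒᵖ n ↔ FiniteDims C n := by
  refine ⟨fun h => ⟨fun Q hQ => ?_, fun I hI => ?_⟩, fun h => ⟨fun Q hQ => ?_, fun I hI => ?_⟩⟩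
  · exact hasProjectiveDimensionLT_op_iff.1 (h.2 (op Q) inferInstance)
  · exact hasInjectiveDimensionLT_op_iff.1 (h.1 (op I) inferInstance)
  · exact hasInjectiveDimensionLT_op_iff.2 (h.2 Q.unop inferInstance)
  · exact hasProjectiveDimensionLT_op_iff.2 (h.1 I.unop inferInstance)

/-- Gorenstein projective and Gorenstein injective dimension have the same uniform bounds. -/
lemma forall_gpDim_op_iff [EnoughProjectives C] [EnoughInjectives C] {n : ℕ} :
    (∀ M : Cᵒᵖ, GPDim n M) ↔ ∀ M : C, GPDim n M := by
  rw [forall_gpDim_iff, forall_gpDim_iff, finiteDims_op_iff]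

end Duality

/-! ### Gorenstein projective and injective modules -/

/-- If every element of `S` has an `r`-successor and an `r`-predecessor in `S`, then it lies at any
given place `k` of a two-sided infinite `r`-chain in `S`. -/
lemma exists_int_chain {T : Type*} {S : T → Prop} {r : T → T → Prop}
    (hf : ∀ x, S x → ∃ y, S y ∧ r x y) (hb : ∀ x, S x → ∃ y, S y ∧ r y x) {x : T} (hx : S x)
    (k : ℤ) : ∃ z : ℤ → T, z k = x ∧ ∀ i, S (z i) ∧ r (z i) (z (i + 1)) := by
  choose f hfS hfr using fun x : Subtype S => hf x x.2
  choose b hbS hbr using fun x : Subtype S => hb x x.2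
  let F : Subtype S → Subtype S := fun x => ⟨f x, hfS x⟩
  let B : Subtype S → Subtype S := fun x => ⟨b x, hbS x⟩
  let z : ℤ → Subtype S := fun i =>
    if k ≤ i then F^[(i - k).toNat] ⟨x, hx⟩ else B^[(k - i).toNat] ⟨x, hx⟩
  refine ⟨fun i => z i, by simp [z], fun i => ⟨(z i).2, ?_⟩⟩
  dsimp only [z]
  split_ifs with h₁ h₂ h₂
  · rw [show (i + 1 - k).toNat = (i - k).toNat + 1 by omega, Function.iterate_succ_apply']
    exact hfr _
  · omega
  · rw [show (i + 1 - k).toNat = 0 by omega, show (k - i).toNat = 1 by omega]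
    exact hbr _
  · rw [show (k - i).toNat = (k - (i + 1)).toNat + 1 by omega, Function.iterate_succ_apply']
    exact hbr _

section Modules

variable {R : Type u} [Ring R]

lemma moduleCat_shortExact {A B D : ModuleCat.{u} R} {f : A →ₗ[R] B} {g : B →ₗ[R] D}
    (hf : Function.Injective f) (hfg : Function.Exact f g) (hg : Function.Surjective g) :
    ∃ w, (ShortComplex.mk (ModuleCat.ofHom f) (ModuleCat.ofHom g) w).ShortExact :=
  ⟨by ext x; exact hfg.apply_apply_eq_zero x, ModuleCat.shortComplex_shortExact _ hfg hf hg⟩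

lemma Ses.of_linearMap {A B D : ModuleCat.{u} R} {f : A →ₗ[R] B} {g : B →ₗ[R] D}
    (hf : Function.Injective f) (hfg : Function.Exact f g) (hg : Function.Surjective g) :
    Ses A B D :=
  ⟨_, _, moduleCat_shortExact hf hfg hg⟩

lemma Ses.exists_linearMap {A B D : ModuleCat.{u} R} (h : Ses A B D) :
    ∃ (f : A →ₗ[R] B) (g : B →ₗ[R] D),
      Function.Injective f ∧ Function.Exact f g ∧ Function.Surjective g := by
  obtain ⟨f, g, w, h⟩ := h
  exact ⟨f.hom, g.hom, h.moduleCat_injective_f,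
    (ShortComplex.ShortExact.moduleCat_exact_iff_function_exact _).1 h.exact,
    h.moduleCat_surjective_g⟩

lemma moduleCat_projective_iff {P : ModuleCat.{u} R} : Projective P ↔ Module.Projective R P :=
  (IsProjective.iff_projective P).symm

lemma moduleCat_injective_iff {I : ModuleCat.{u} R} : Injective I ↔ Module.Injective R I :=
  (Module.injective_iff_injective_object R I).symm

namespace ExactSeq

variable (P : ExactSeq R)

/-- The image of a differential of an exact sequence. -/
def im (i : ℤ) : ModuleCat.{u} R := ModuleCat.of R (LinearMap.range (P.d i))

/-- The inclusion of the image of a differential. -/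
def imι (i : ℤ) : P.im i →ₗ[R] P.X (i + 1) := (LinearMap.range (P.d i)).subtype

/-- The corestriction of a differential to its image. -/
def imπ (i : ℤ) : P.X i →ₗ[R] P.im i := (P.d i).rangeRestrict

lemma imι_comp_imπ (i : ℤ) : P.imι i ∘ₗ P.imπ i = P.d i := rfl

lemma imι_injective (i : ℤ) : Function.Injective (P.imι i) := Subtype.val_injective

lemma imπ_surjective (i : ℤ) : Function.Surjective (P.imπ i) := (P.d i).surjective_rangeRestrict

lemma exact_imι_imπ (i : ℤ) : Function.Exact (P.imι i) (P.imπ (i + 1)) := by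
  intro x
  have : P.imπ (i + 1) x = 0 ↔ P.d (i + 1) x = 0 := by
    rw [← P.imι_comp_imπ, LinearMap.comp_apply, map_eq_zero_iff _ (P.imι_injective _)]
  rw [this, P.exact i x]
  exact ⟨fun ⟨y, hy⟩ => ⟨P.imπ i y, hy⟩, fun ⟨⟨_, y, rfl⟩, hy⟩ => ⟨y, hy⟩⟩

lemma ses (i : ℤ) : Ses (P.im i) (P.X (i + 1)) (P.im (i + 1)) :=
  .of_linearMap (P.imι_injective i) (P.exact_imι_imπ i) (P.imπ_surjective (i + 1))

end ExactSeq

lemma LinearMap.exists_comp_eq_of_surjective {A B D : Type*} [AddCommGroup A] [AddCommGroup B]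
    [AddCommGroup D] [Module R A] [Module R B] [Module R D] {g : A →ₗ[R] B}
    (hg : Function.Surjective g) {k : A →ₗ[R] D} (hk : ∀ x, g x = 0 → k x = 0) :
    ∃ l : B →ₗ[R] D, l ∘ₗ g = k := by
  refine ⟨(LinearMap.ker g).liftQ k
      (fun x hx => LinearMap.mem_ker.2 (hk x (LinearMap.mem_ker.1 hx))) ∘ₗ
    (g.quotKerEquivOfSurjective hg).symm.toLinearMap, ?_⟩
  ext x
  have : (g.quotKerEquivOfSurjective hg).symm (g x) = (LinearMap.ker g).mkQ x := by
    rw [LinearEquiv.symm_apply_eq]; rfl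
  rw [LinearMap.comp_apply, LinearMap.comp_apply, LinearEquiv.coe_coe, this,
    Submodule.mkQ_apply, Submodule.liftQ_apply]

lemma LinearMap.exists_comp_eq_of_injective {A B D : Type*} [AddCommGroup A] [AddCommGroup B]
    [AddCommGroup D] [Module R A] [Module R B] [Module R D] {f : A →ₗ[R] B}
    (hf : Function.Injective f) {k : D →ₗ[R] B} (hk : ∀ x, ∃ y, f y = k x) :
    ∃ l : D →ₗ[R] A, f ∘ₗ l = k := by
  refine ⟨(LinearEquiv.ofInjective f hf).symm.toLinearMap ∘ₗ k.codRestrict _ hk, ?_⟩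
  ext x
  exact congrArg Subtype.val ((LinearEquiv.ofInjective f hf).apply_symm_apply
    (k.codRestrict _ hk x))

lemma isGP_of_isGorensteinProjective {M : Type u} [AddCommGroup M] [Module R M]
    (h : IsGorensteinProjective R M) : IsGP (ModuleCat.of R M) := by
  obtain ⟨P, hP, hQ, ⟨e⟩⟩ := h
  have hv (i : ℤ) : ExtVanish 0 (P.im i) := by
    refine extVanish_of_forall_extension (fun M => ∃ i, M = P.im i) ?_ ⟨i, rfl⟩
    rintro _ ⟨i, rfl⟩
    obtain ⟨i, rfl⟩ : ∃ j, i = j + 1 + 1 := ⟨i - 1 - 1, by omega⟩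
    obtain ⟨w, hs⟩ := moduleCat_shortExact (P.imι_injective (i + 1)) (P.exact_imι_imπ (i + 1))
      (P.imπ_surjective (i + 1 + 1))
    refine ⟨_, _, _, _, w, hs, moduleCat_projective_iff.2 (hP _), ⟨_, rfl⟩, fun Q hQ' k => ?_⟩
    obtain ⟨l, hl⟩ := (hQ Q (moduleCat_projective_iff.1 hQ') i (k.hom ∘ₗ P.imπ (i + 1))).1 (by
      ext x
      have : P.imπ (i + 1) (P.d i x) = 0 := (P.exact_imι_imπ i).apply_apply_eq_zero (P.imπ i x)
      simp [this])
    refine ⟨ModuleCat.ofHom l, ?_⟩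
    ext x
    obtain ⟨y, rfl⟩ := P.imπ_surjective _ x
    exact LinearMap.congr_fun hl y
  refine IsGP.of_iso (G := P.im 0) e.symm.toModuleIso ⟨fun M => ∃ i, M = P.im i, ⟨0, rfl⟩, ?_⟩
  rintro _ ⟨i, rfl⟩
  exact ⟨hv i, _, _, moduleCat_projective_iff.2 (hP _), P.ses i, _, rfl⟩

lemma isGP_op_of_isGorensteinInjective {M : Type u} [AddCommGroup M] [Module R M]
    (h : IsGorensteinInjective R M) : IsGP (op (ModuleCat.of R M)) := by
  obtain ⟨P, hP, hQ, ⟨e⟩⟩ := h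
  have hP' (i) : Projective (op (P.X i)) :=
    Injective.injective_iff_projective_op.1 (moduleCat_injective_iff.2 (hP _))
  have hv (i : ℤ) : ExtVanish 0 (op (P.im i)) := by
    refine extVanish_of_forall_extension (fun M => ∃ i, M = op (P.im i)) ?_ ⟨i, rfl⟩
    rintro _ ⟨i, rfl⟩
    obtain ⟨w, hs⟩ := moduleCat_shortExact (P.imι_injective i) (P.exact_imι_imπ i)
      (P.imπ_surjective (i + 1))
    refine ⟨_, _, _, _, _, hs.op, hP' _, ⟨_, rfl⟩, fun Q hQ' k => ?_⟩
    obtain ⟨l, hl⟩ := (hQ Q.unop (moduleCat_injective_iff.1 inferInstance) (i + 1)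
      (P.imι (i + 1) ∘ₗ k.unop.hom)).1 (by
        ext x
        obtain ⟨y, hy⟩ := P.imπ_surjective (i + 1) (k.unop.hom x)
        have := (P.exact (i + 1)).apply_apply_eq_zero y
        rw [← P.imι_comp_imπ (i + 1)] at this
        dsimp at this ⊢
        rwa [← hy])
    refine ⟨(ModuleCat.ofHom l).op, Quiver.Hom.unop_inj ?_⟩
    ext x
    exact P.imι_injective _ (LinearMap.congr_fun hl x)
  refine IsGP.of_iso (G := op (P.im 0)) e.toModuleIso.op
    ⟨fun M => ∃ i, M = op (P.im i), ⟨0, rfl⟩, ?_⟩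
  rintro _ ⟨i, rfl⟩
  refine ⟨hv i, ?_⟩
  obtain ⟨i, rfl⟩ : ∃ j, i = j + 1 := ⟨i - 1, by omega⟩
  exact ⟨_, _, hP' _, (P.ses i).op, _, rfl⟩

/-- Short exact sequences `0 → Z i → P i → Z (i + 1) → 0` splice to an exact sequence. -/
def ExactSeq.splice (Z P : ℤ → ModuleCat.{u} R) (f : ∀ i, Z i →ₗ[R] P i)
    (g : ∀ i, P i →ₗ[R] Z (i + 1)) (hf : ∀ i, Function.Injective (f i))
    (hfg : ∀ i, Function.Exact (f i) (g i)) (hg : ∀ i, Function.Surjective (g i)) :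
    ExactSeq R where
  X := P
  d i := f (i + 1) ∘ₗ g i
  exact i x := by
    rw [LinearMap.comp_apply, map_eq_zero_iff _ (hf _), hfg (i + 1) x]
    exact ⟨fun ⟨y, hy⟩ => by obtain ⟨z, rfl⟩ := hg i y; exact ⟨z, hy⟩, fun ⟨z, hz⟩ => ⟨g i z, hz⟩⟩

lemma ExactSeq.nonempty_splice_equiv (Z P : ℤ → ModuleCat.{u} R) (f : ∀ i, Z i →ₗ[R] P i)
    (g : ∀ i, P i →ₗ[R] Z (i + 1)) (hf : ∀ i, Function.Injective (f i))
    (hfg : ∀ i, Function.Exact (f i) (g i)) (hg : ∀ i, Function.Surjective (g i)) :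
    Nonempty (Z 1 ≃ₗ[R] LinearMap.range ((ExactSeq.splice Z P f g hf hfg hg).d 0)) := by
  have : LinearMap.range (f (0 + 1) ∘ₗ g 0) = LinearMap.range (f 1) :=
    LinearMap.range_comp_of_range_eq_top _ (LinearMap.range_eq_top.2 (hg 0))
  exact ⟨(LinearEquiv.ofInjective (f 1) (hf 1)).trans (LinearEquiv.ofEq _ _ this.symm)⟩

lemma isGorensteinProjective_of_isGP {M : Type u} [AddCommGroup M] [Module R M]
    (h : IsGP (ModuleCat.of R M)) : IsGorensteinProjective R M := by
  obtain ⟨Z, hZ, hs⟩ := exists_int_chain (S := IsGP)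
    (r := fun A B : ModuleCat.{u} R => ∃ P, Projective P ∧ Ses A P B)
    (fun A hA => by
      obtain ⟨P, G, hP, hs, hG⟩ := hA.exists_ses
      exact ⟨G, hG, P, hP, hs⟩)
    (fun A hA => ⟨_, .of_ses (.of_epi (Projective.π A)) inferInstance hA, _, inferInstance,
      .of_epi (Projective.π A)⟩) h 1
  choose hG P hP hs using hs
  choose f g hf hfg hg using fun i => (hs i).exists_linearMap
  have key (Q : ModuleCat.{u} R) (hQ : Module.Projective R Q) (i : ℤ) : Function.Exact
      (fun l : P (i + 1 + 1) →ₗ[R] Q => l ∘ₗ (f (i + 1 + 1) ∘ₗ g (i + 1)))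
      (fun k : P (i + 1) →ₗ[R] Q => k ∘ₗ (f (i + 1) ∘ₗ g i)) := by
    intro k
    dsimp only
    constructor
    · intro hk
      obtain ⟨k', hk'⟩ := LinearMap.exists_comp_eq_of_surjective (hg (i + 1)) (k := k) (by
        intro x hx
        obtain ⟨y, rfl⟩ := (hfg _ x).1 hx
        obtain ⟨z, rfl⟩ := hg _ y
        exact LinearMap.congr_fun hk z)
      obtain ⟨w, hs'⟩ := moduleCat_shortExact (hf (i + 1 + 1)) (hfg (i + 1 + 1)) (hg (i + 1 + 1))
      obtain ⟨l, hl⟩ := (hG (i + 1 + 1 + 1)).extVanish.exists_extension hs'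
        (moduleCat_projective_iff.2 hQ) (ModuleCat.ofHom k')
      refine ⟨l.hom, ?_⟩
      have hl' : l.hom ∘ₗ f (i + 1 + 1) = k' := congr(($hl).hom)
      rw [← hk', ← hl', LinearMap.comp_assoc]
    · rintro ⟨l, rfl⟩
      ext x
      simp [(hfg _).apply_apply_eq_zero]
  refine ⟨ExactSeq.splice Z P f g hf hfg hg, fun i => moduleCat_projective_iff.1 (hP i), key, ?_⟩
  have := ExactSeq.nonempty_splice_equiv Z P f g hf hfg hg
  rwa [hZ] at this

lemma isGorensteinInjective_of_isGP_op {M : Type u} [AddCommGroup M] [Module R M]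
    (h : IsGP (op (ModuleCat.of R M))) : IsGorensteinInjective R M := by
  obtain ⟨Z, hZ, hs⟩ := exists_int_chain (S := fun A : ModuleCat.{u} R => IsGP (op A))
    (r := fun A B => ∃ I, Injective I ∧ Ses A I B)
    (fun A hA => ⟨_, .of_ses (Ses.of_mono (Injective.ι A)).op inferInstance hA, _, inferInstance,
      .of_mono (Injective.ι A)⟩)
    (fun A hA => by
      obtain ⟨P, G, hP, hs, hG⟩ := hA.exists_ses
      exact ⟨G.unop, hG, P.unop, inferInstance, hs.of_op⟩) h 1
  choose hG P hP hs using hs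
  choose f g hf hfg hg using fun i => (hs i).exists_linearMap
  have key (E : ModuleCat.{u} R) (hE : Module.Injective R E) (i : ℤ) : Function.Exact
      (fun l : E →ₗ[R] P i => (f (i + 1) ∘ₗ g i) ∘ₗ l)
      (fun k : E →ₗ[R] P (i + 1) => (f (i + 1 + 1) ∘ₗ g (i + 1)) ∘ₗ k) := by
    intro k
    dsimp only
    constructor
    · intro hk
      obtain ⟨k', hk'⟩ := LinearMap.exists_comp_eq_of_injective (hf (i + 1)) (k := k) (by
        intro x
        refine (hfg _ _).1 (hf _ ?_)
        rw [map_zero]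
        exact LinearMap.congr_fun hk x)
      obtain ⟨w, hs'⟩ := moduleCat_shortExact (hf i) (hfg i) (hg i)
      have : Injective E := moduleCat_injective_iff.2 hE
      obtain ⟨l, hl⟩ := (hG i).extVanish.exists_extension hs'.op
        (Q := op E) inferInstance (ModuleCat.ofHom k').op
      refine ⟨l.unop.hom, ?_⟩
      have hl' : g i ∘ₗ l.unop.hom = k' := congr(($hl).unop.hom)
      dsimp only
      rw [← hk', ← hl', LinearMap.comp_assoc]
    · rintro ⟨l, rfl⟩
      ext x
      simp [(hfg _).apply_apply_eq_zero]
  refine ⟨ExactSeq.splice Z P f g hf hfg hg, fun i => moduleCat_injective_iff.1 (hP i), key, ?_⟩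
  have := ExactSeq.nonempty_splice_equiv Z P f g hf hfg hg
  rwa [hZ] at this

end Modules

/-! ### Gorenstein dimensions of modules through resolutions -/

section Resolutions

variable {R : Type u} [Ring R]

lemma isGorensteinProjective_iff {M : Type u} [AddCommGroup M] [Module R M] :
    IsGorensteinProjective R M ↔ IsGP (ModuleCat.of R M) :=
  ⟨isGP_of_isGorensteinProjective, isGorensteinProjective_of_isGP⟩

lemma isGorensteinInjective_iff {M : Type u} [AddCommGroup M] [Module R M] :
    IsGorensteinInjective R M ↔ IsGP (op (ModuleCat.of R M)) :=
  ⟨isGP_op_of_isGorensteinInjective, isGorensteinInjective_of_isGP_op⟩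

lemma gpDim_of_hasResolution {n : ℕ} {M : Type u} [AddCommGroup M] [Module R M]
    (h : HasGorensteinProjectiveResolution R M n) : GPDim n (ModuleCat.of R M) := by
  induction n generalizing M with
  | zero =>
    obtain ⟨G, d, ε, hG, hs, hε, h₀, -⟩ := h
    have := hs 1 one_pos
    have hi : Function.Injective ε := by
      rw [injective_iff_map_eq_zero]
      intro x hx
      obtain ⟨y, rfl⟩ := (h₀ x).1 hx
      rw [Subsingleton.elim y 0, map_zero]
    exact IsGP.of_iso (LinearEquiv.ofBijective ε ⟨hi, hε⟩).toModuleIso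
      (isGorensteinProjective_iff.1 (hG 0))
  | succ n ih =>
    obtain ⟨G, d, ε, hG, hs, hε, h₀, hd⟩ := h
    let d₀ : G 1 →ₗ[R] LinearMap.ker ε :=
      (d 0).codRestrict _ fun x => h₀.apply_apply_eq_zero x
    have hd₀ (x) : d₀ x = 0 ↔ d 0 x = 0 := by
      rw [← Subtype.val_inj]; rfl
    have hK : HasGorensteinProjectiveResolution R (LinearMap.ker ε) n := by
      refine ⟨fun i => G (i + 1), fun i => d (i + 1), d₀, fun i => hG _,
        fun i hi => hs _ (by omega), fun ⟨x, hx⟩ => ?_, fun x => ?_, fun i => hd (i + 1)⟩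
      · obtain ⟨y, rfl⟩ := (h₀ x).1 hx
        exact ⟨y, rfl⟩
      · rw [hd₀]; exact hd 0 x
    refine GPDim.of_ses (K := ModuleCat.of R (LinearMap.ker ε)) (G := G 0)
      (.of_linearMap (f := (LinearMap.ker ε).subtype) (g := ε) Subtype.val_injective ?_ hε)
      (isGorensteinProjective_iff.1 (hG 0)) (ih hK)
    intro x
    simp

lemma hasResolution_of_gpDim {n : ℕ} {M : ModuleCat.{u} R} (h : GPDim n M) :
    HasGorensteinProjectiveResolution R M n := by
  induction n generalizing M with
  | zero =>
    let Z : ModuleCat.{u} R := ModuleCat.of R PUnit.{u+1}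
    refine ⟨fun | 0 => M | _ + 1 => Z, fun _ => 0, LinearMap.id, ?_, ?_, Function.surjective_id,
      ?_, ?_⟩
    · rintro (_ | i)
      · exact isGorensteinProjective_iff.2 h
      · exact isGorensteinProjective_iff.2 (isGP_of_projective
          (moduleCat_projective_iff.2 (inferInstanceAs (Module.Projective R PUnit.{u+1}))))
    · rintro (_ | i) hi
      · omega
      · exact inferInstanceAs (Subsingleton PUnit.{u+1})
    · intro x
      exact ⟨fun hx => ⟨0, hx.symm⟩, fun ⟨y, hy⟩ => hy.symm⟩
    · exact fun i x => ⟨fun _ => ⟨0, Subsingleton.elim (α := PUnit.{u+1}) _ _⟩, fun _ => rfl⟩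
  | succ n ih =>
    obtain ⟨K, P, hP, hs, hK⟩ := h
    obtain ⟨f, g, hf, hfg, hg⟩ := hs.exists_linearMap
    obtain ⟨G, d, ε, hG, hs, hε, h₀, hd⟩ := ih hK
    refine ⟨fun | 0 => P | i + 1 => G i, fun | 0 => f ∘ₗ ε | i + 1 => d i, g, ?_, ?_, hg, ?_, ?_⟩
    · rintro (_ | i)
      · exact isGorensteinProjective_iff.2 (isGP_of_projective hP)
      · exact hG i
    · rintro (_ | i) hi
      · omega
      · exact hs i (by omega)
    · intro x
      rw [hfg x]
      exact ⟨fun ⟨y, hy⟩ => by obtain ⟨z, rfl⟩ := hε y; exact ⟨z, hy⟩, fun ⟨z, hz⟩ => ⟨ε z, hz⟩⟩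
    · rintro (_ | i)
      · intro x
        exact (map_eq_zero_iff f hf).trans (h₀ x)
      · exact hd i

lemma gpDim_op_of_hasResolution {n : ℕ} {M : Type u} [AddCommGroup M] [Module R M]
    (h : HasGorensteinInjectiveResolution R M n) : GPDim n (op (ModuleCat.of R M)) := by
  induction n generalizing M with
  | zero =>
    obtain ⟨G, d, η, hG, hs, hη, h₀, -⟩ := h
    have := hs 1 one_pos
    have hi : Function.Surjective η := fun x => (h₀ x).1 (Subsingleton.elim _ _)
    exact IsGP.of_iso (LinearEquiv.ofBijective η ⟨hη, hi⟩).toModuleIso.op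
      (isGorensteinInjective_iff.1 (hG 0))
  | succ n ih =>
    obtain ⟨G, d, η, hG, hs, hη, h₀, hd⟩ := h
    have hk : LinearMap.range η ≤ LinearMap.ker (d 0) := by
      rintro _ ⟨x, rfl⟩
      exact h₀.apply_apply_eq_zero x
    let d₀ : (G 0 ⧸ LinearMap.range η) →ₗ[R] G 1 := (LinearMap.range η).liftQ (d 0) hk
    have hK : HasGorensteinInjectiveResolution R (G 0 ⧸ LinearMap.range η) n := by
      refine ⟨fun i => G (i + 1), fun i => d (i + 1), d₀, fun i => hG _,
        fun i hi => hs _ (by omega), ?_, fun x => ?_, fun i => hd (i + 1)⟩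
      · rw [injective_iff_map_eq_zero]
        intro x hx
        obtain ⟨x, rfl⟩ := Submodule.mkQ_surjective _ x
        rw [Submodule.mkQ_apply, Submodule.Quotient.mk_eq_zero]
        exact (h₀ x).1 hx
      · rw [hd 0 x]
        constructor
        · rintro ⟨y, rfl⟩
          exact ⟨Submodule.Quotient.mk y, rfl⟩
        · rintro ⟨y, rfl⟩
          obtain ⟨y, rfl⟩ := Submodule.mkQ_surjective _ y
          exact ⟨y, rfl⟩
    refine GPDim.of_ses (K := op (ModuleCat.of R (G 0 ⧸ LinearMap.range η))) (G := op (G 0))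
      (Ses.op (A := ModuleCat.of R M)
        (.of_linearMap (f := η) (g := (LinearMap.range η).mkQ) hη ?_ (Submodule.mkQ_surjective _)))
      (isGorensteinInjective_iff.1 (hG 0)) (ih hK)
    intro x
    simp

lemma hasResolution_of_gpDim_op {n : ℕ} {M : ModuleCat.{u} R} (h : GPDim n (op M)) :
    HasGorensteinInjectiveResolution R M n := by
  induction n generalizing M with
  | zero =>
    let Z : ModuleCat.{u} R := ModuleCat.of R PUnit.{u+1}
    have hZ : Injective Z := moduleCat_injective_iff.2 ⟨fun _ _ _ _ _ _ f _ g =>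
      ⟨0, fun x => Subsingleton.elim (α := PUnit.{u+1}) _ _⟩⟩
    refine ⟨fun | 0 => M | _ + 1 => Z, fun _ => 0, LinearMap.id, ?_, ?_, Function.injective_id,
      ?_, ?_⟩
    · rintro (_ | i)
      · exact isGorensteinInjective_iff.2 h
      · exact isGorensteinInjective_iff.2 (isGP_of_projective
          (inferInstanceAs (Projective (op Z))))
    · rintro (_ | i) hi
      · omega
      · exact inferInstanceAs (Subsingleton PUnit.{u+1})
    · intro x
      exact ⟨fun _ => ⟨x, rfl⟩, fun _ => rfl⟩
    · exact fun i x => ⟨fun _ => ⟨0, Subsingleton.elim (α := PUnit.{u+1}) _ _⟩, fun _ => rfl⟩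
  | succ n ih =>
    obtain ⟨K, P, hP, hs, hK⟩ := h
    obtain ⟨f, g, hf, hfg, hg⟩ := (Ses.of_op (D := K.unop) (B := P.unop) hs).exists_linearMap
    obtain ⟨G, d, η, hG, hs, hη, h₀, hd⟩ := ih (M := K.unop) hK
    refine ⟨fun | 0 => P.unop | i + 1 => G i, fun | 0 => η ∘ₗ g | i + 1 => d i, f, ?_, ?_, hf, ?_,
      ?_⟩
    · rintro (_ | i)
      · exact isGorensteinInjective_iff.2 (isGP_of_projective hP)
      · exact hG i
    · rintro (_ | i) hi
      · omega
      · exact hs i (by omega)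
    · intro x
      exact (map_eq_zero_iff η hη).trans (hfg x)
    · rintro (_ | i)
      · intro x
        refine (h₀ x).trans ?_
        exact ⟨fun ⟨y, hy⟩ => by obtain ⟨z, rfl⟩ := hg y; exact ⟨z, hy⟩, fun ⟨z, hz⟩ => ⟨g z, hz⟩⟩
      · exact hd i

lemma iInf_le_natCast_iff {p : ℕ → Prop} (hp : ∀ {m n}, m ≤ n → p m → p n) {n : ℕ} :
    (⨅ (m : ℕ) (_ : p m), (m : ℕ∞)) ≤ n ↔ p n := by
  refine ⟨fun h => ?_, fun h => iInf₂_le n h⟩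
  by_contra hn
  have : ((n + 1 : ℕ) : ℕ∞) ≤ n := (le_iInf₂ fun m hm => by
    refine Nat.cast_le.2 ?_
    by_contra hmn
    exact hn (hp (by omega) hm)).trans h
  have := Nat.cast_le.1 this
  omega

lemma gpd_le_iff {M : Type u} [AddCommGroup M] [Module R M] {n : ℕ} :
    Gpd R M ≤ n ↔ GPDim n (ModuleCat.of R M) := by
  have (n : ℕ) : HasGorensteinProjectiveResolution R M n ↔ GPDim n (ModuleCat.of R M) :=
    ⟨gpDim_of_hasResolution, hasResolution_of_gpDim⟩
  simp_rw [Gpd, this]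
  exact iInf_le_natCast_iff fun h => GPDim.mono h

lemma gid_le_iff {M : Type u} [AddCommGroup M] [Module R M] {n : ℕ} :
    Gid R M ≤ n ↔ GPDim n (op (ModuleCat.of R M)) := by
  have (n : ℕ) : HasGorensteinInjectiveResolution R M n ↔ GPDim n (op (ModuleCat.of R M)) :=
    ⟨gpDim_op_of_hasResolution, hasResolution_of_gpDim_op⟩
  simp_rw [Gid, this]
  exact iInf_le_natCast_iff fun h => GPDim.mono h

end Resolutions

/-! ### Quasi-Frobenius rings -/

section SelfInjective

variable {R : Type u} [Ring R]

/-- The left ideal of all `x` with `x * y = 0` for every `y` in a set. -/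
def leftAnn (S : Set R) : Submodule R R where
  carrier := {x | ∀ y ∈ S, x * y = 0}
  add_mem' ha hb y hy := by rw [add_mul, ha y hy, hb y hy, add_zero]
  zero_mem' y _ := zero_mul y
  smul_mem' c x hx y hy := by rw [smul_eq_mul, mul_assoc, hx y hy, mul_zero]

/-- The right ideal of all `y` with `x * y = 0` for every `x` in a set. -/
def rightAnn (S : Set R) : Submodule Rᵐᵒᵖ R where
  carrier := {y | ∀ x ∈ S, x * y = 0}
  add_mem' ha hb x hx := by rw [mul_add, ha x hx, hb x hx, add_zero]
  zero_mem' x _ := mul_zero x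
  smul_mem' c y hy x hx := by
    rw [MulOpposite.smul_eq_mul_unop, ← mul_assoc, hy x hx, zero_mul]

lemma leftAnn_anti {S T : Set R} (h : S ⊆ T) : leftAnn T ≤ leftAnn S := fun _ hx y hy => hx y (h hy)

lemma subset_rightAnn_leftAnn (S : Set R) : S ⊆ rightAnn (leftAnn S : Set R) :=
  fun _ hy _ hx => hx _ hy

/-- Over a left self-injective ring, finitely generated right ideals are right annihilators. -/
lemma rightAnn_leftAnn [Module.Injective R R] {J : Submodule Rᵐᵒᵖ R} (hJ : J.FG) :
    rightAnn (leftAnn (J : Set R) : Set R) = J := by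
  refine le_antisymm (fun b hb => ?_) (subset_rightAnn_leftAnn _)
  obtain ⟨n, a, rfl⟩ := Submodule.fg_iff_exists_fin_generating_family.1 hJ
  let g : R →ₗ[R] (Fin n → R) := LinearMap.toSpanSingleton R _ a
  -- `x • a ↦ x * b` is well defined on `R • a ⊆ R ^ n`, and extends to `R ^ n`
  obtain ⟨l, hl⟩ := LinearMap.exists_comp_eq_of_surjective g.surjective_rangeRestrict
    (k := LinearMap.toSpanSingleton R R b) (by
      intro x hx
      have hx' (i) : x * a i = 0 := congrFun (congrArg Subtype.val hx) i
      refine hb x fun y hy => ?_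
      induction hy using Submodule.span_induction with
      | mem y hy => obtain ⟨i, rfl⟩ := hy; exact hx' i
      | zero => exact mul_zero x
      | add y z _ _ hy hz => rw [mul_add, hy, hz, add_zero]
      | smul c y _ hy => rw [MulOpposite.smul_eq_mul_unop, ← mul_assoc, hy, zero_mul])
  obtain ⟨h, hh⟩ := Module.Injective.extension_property R R _ _ (LinearMap.range g).subtype
    Subtype.val_injective l
  have hb' : b = h a := by
    have h₁ := LinearMap.congr_fun hl 1
    have h₂ := LinearMap.congr_fun hh (g.rangeRestrict 1)
    simp only [LinearMap.comp_apply] at h₁ h₂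
    rw [← h₂] at h₁
    simpa [g] using h₁.symm
  rw [hb', LinearMap.pi_apply_eq_sum_univ h a]
  refine Submodule.sum_mem _ fun i _ => ?_
  exact (Submodule.span Rᵐᵒᵖ (Set.range a)).smul_mem
    (MulOpposite.op (h fun k => if i = k then 1 else 0)) (Submodule.subset_span ⟨i, rfl⟩)

/-- A left self-injective left Artinian ring is right Noetherian. -/
lemma isNoetherian_op_of_injective [Module.Injective R R] [IsArtinian R R] :
    IsNoetherian Rᵐᵒᵖ R := by
  refine ⟨fun J => ?_⟩
  obtain ⟨_, ⟨J₀, ⟨hJ₀, hfg⟩, rfl⟩, hmin⟩ := IsArtinian.set_has_minimal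
    ((fun J' : Submodule Rᵐᵒᵖ R => leftAnn (J' : Set R)) '' {J' | J' ≤ J ∧ J'.FG})
    ⟨_, ⊥, ⟨bot_le, Submodule.fg_bot⟩, rfl⟩
  convert hfg
  refine le_antisymm (fun a ha => ?_) hJ₀
  have hfg' : (J₀ ⊔ Submodule.span Rᵐᵒᵖ {a}).FG := hfg.sup (Submodule.fg_span_singleton a)
  have hle : leftAnn ((J₀ ⊔ Submodule.span Rᵐᵒᵖ {a} : Submodule Rᵐᵒᵖ R) : Set R) ≤
    leftAnn (J₀ : Set R) := leftAnn_anti (SetLike.coe_subset_coe.2 le_sup_left)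
  have heq := (eq_of_le_of_not_lt hle (hmin _ ⟨_, ⟨sup_le hJ₀
    ((Submodule.span_singleton_le_iff_mem _ _).2 ha), hfg'⟩, rfl⟩))
  rw [← rightAnn_leftAnn hfg, ← heq, rightAnn_leftAnn hfg']
  exact Submodule.mem_sup_right (Submodule.mem_span_singleton_self a)

/-- If injective left modules are projective, then left ideals are left annihilators, because
`R ⧸ I` embeds into a projective module. -/
lemma leftAnn_rightAnn (hi : ∀ I : ModuleCat.{u} R, Injective I → Projective I)
    (I : Submodule R R) : leftAnn (rightAnn (I : Set R) : Set R) = I := by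
  refine le_antisymm (fun x hx => ?_) (fun x hx y hy => hy x hx)
  let E := Injective.under (ModuleCat.of R (R ⧸ I))
  let j : (R ⧸ I) →ₗ[R] E := (Injective.ι (ModuleCat.of R (R ⧸ I))).hom
  have hj : Function.Injective j := (ModuleCat.mono_iff_injective _).1
    (inferInstanceAs (Mono (Injective.ι (ModuleCat.of R (R ⧸ I)))))
  have := moduleCat_projective_iff.1 (hi E inferInstance)
  obtain ⟨s, hs⟩ := Module.projective_def'.1 this
  -- the coordinates of a section of `R^(E) → E` are functionals that separate the points of `E`
  have key (z : R ⧸ I) (hz : ∀ e, s (j z) e = 0) : z = 0 := by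
    refine hj ?_
    have h₁ : s (j z) = 0 := Finsupp.ext hz
    have h₂ := LinearMap.congr_fun hs (j z)
    rw [LinearMap.comp_apply, h₁] at h₂
    rw [map_zero, ← LinearMap.id_apply (R := R) (j z), ← h₂, map_zero]
  have hmul (y : R) (e) : s (j (Submodule.Quotient.mk y)) e =
      y * s (j (Submodule.Quotient.mk 1)) e := by
    have : (Submodule.Quotient.mk y : R ⧸ I) = y • Submodule.Quotient.mk 1 := by
      rw [← Submodule.Quotient.mk_smul, smul_eq_mul, mul_one]
    rw [this, map_smul, map_smul, Finsupp.smul_apply, smul_eq_mul]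
  rw [← Submodule.Quotient.mk_eq_zero]
  refine key _ fun e => ?_
  rw [hmul]
  refine hx _ fun y hy => ?_
  rw [← hmul, (Submodule.Quotient.mk_eq_zero I).2 hy, map_zero, map_zero, Finsupp.zero_apply]

/-- If one-sided ideals satisfy the double annihilator conditions, then every homomorphism from a
finitely generated right ideal to `R` is a left multiplication. -/
lemma exists_eq_mul_left (hl : ∀ I : Submodule R R, leftAnn (rightAnn (I : Set R) : Set R) = I)
    (hr : ∀ J : Submodule Rᵐᵒᵖ R, J.FG → rightAnn (leftAnn (J : Set R) : Set R) = J)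
    (J : Submodule Rᵐᵒᵖ R) (hJ : J.FG) (f : J →ₗ[Rᵐᵒᵖ] R) : ∃ c : R, ∀ x : J, f x = c * x := by
  induction J, hJ using Submodule.fg_induction with
  | singleton a =>
    let a' : Submodule.span Rᵐᵒᵖ {a} := ⟨a, Submodule.mem_span_singleton_self a⟩
    have hb : f a' ∈
        leftAnn (rightAnn ((Submodule.span R {a} : Submodule R R) : Set R) : Set R) := by
      intro y hy
      have h₀ : MulOpposite.op y • a' = 0 := by
        ext
        exact hy a (Submodule.mem_span_singleton_self a)
      have h₁ := map_smul f (MulOpposite.op y) a'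
      rw [h₀, map_zero] at h₁
      exact h₁.symm
    rw [hl, Submodule.mem_span_singleton] at hb
    obtain ⟨c, hc⟩ := hb
    refine ⟨c, fun ⟨x, hx⟩ => ?_⟩
    obtain ⟨y, rfl⟩ := Submodule.mem_span_singleton.1 hx
    have h₁ := map_smul f y a'
    rw [← hc] at h₁
    refine h₁.trans ?_
    simp [MulOpposite.smul_eq_mul_unop, mul_assoc]
  | sup J₁ J₂ h₁ h₂ ih₁ ih₂ =>
    obtain ⟨c₁, hc₁⟩ := ih₁ (f ∘ₗ Submodule.inclusion le_sup_left)
    obtain ⟨c₂, hc₂⟩ := ih₂ (f ∘ₗ Submodule.inclusion le_sup_right)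
    let I₁ := leftAnn (J₁ : Set R)
    let I₂ := leftAnn (J₂ : Set R)
    -- `c₁ - c₂` annihilates `J₁ ⊓ J₂`, hence lies in `I₁ ⊔ I₂`
    have hd : c₁ - c₂ ∈ I₁ ⊔ I₂ := by
      rw [← hl (I₁ ⊔ I₂)]
      intro x hx
      have hx₁ : x ∈ J₁ := by
        rw [← hr J₁ h₁]; exact fun y hy => hx y (Submodule.mem_sup_left hy)
      have hx₂ : x ∈ J₂ := by
        rw [← hr J₂ h₂]; exact fun y hy => hx y (Submodule.mem_sup_right hy)
      have e₁ := hc₁ ⟨x, hx₁⟩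
      have e₂ := hc₂ ⟨x, hx₂⟩
      rw [sub_mul, sub_eq_zero]
      exact e₁.symm.trans e₂
    obtain ⟨u, hu, v, hv, huv⟩ := Submodule.mem_sup.1 hd
    refine ⟨c₁ - u, fun ⟨x, hx⟩ => ?_⟩
    obtain ⟨y, hy, z, hz, rfl⟩ := Submodule.mem_sup.1 hx
    have e₁ := hc₁ ⟨y, hy⟩
    have e₂ := hc₂ ⟨z, hz⟩
    have e : f ⟨y + z, hx⟩ = f ⟨y, Submodule.mem_sup_left hy⟩ + f ⟨z, Submodule.mem_sup_right hz⟩ :=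
      map_add f ⟨y, Submodule.mem_sup_left hy⟩ ⟨z, Submodule.mem_sup_right hz⟩
    have e₃ : c₁ - u = c₂ + v := by
      rw [sub_eq_iff_eq_add, add_assoc, add_comm v u, huv, add_sub_cancel]
    refine e.trans ?_
    refine (congrArg₂ (· + ·) e₁ e₂).trans ?_
    change c₁ * y + c₂ * z = (c₁ - u) * (y + z)
    have hu' : u * y = 0 := hu y hy
    have hv' : v * z = 0 := hv z hz
    rw [mul_add, sub_mul, hu', e₃, add_mul, hv', sub_zero, add_zero]

/-- `R`, as a right module over itself, is the left regular module over `Rᵐᵒᵖ`. -/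
def unopLinearEquiv : Rᵐᵒᵖ ≃ₗ[Rᵐᵒᵖ] R :=
  { MulOpposite.opAddEquiv.symm with
    map_smul' := fun a b => by simp [MulOpposite.smul_eq_mul_unop] }

lemma injective_op [IsNoetherian Rᵐᵒᵖ R]
    (hl : ∀ I : Submodule R R, leftAnn (rightAnn (I : Set R) : Set R) = I)
    (hr : ∀ J : Submodule Rᵐᵒᵖ R, J.FG → rightAnn (leftAnn (J : Set R) : Set R) = J) :
    Module.Injective Rᵐᵒᵖ R := by
  refine Module.Baer.injective fun I g => ?_
  let e : Rᵐᵒᵖ ≃ₗ[Rᵐᵒᵖ] R := unopLinearEquiv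
  obtain ⟨c, hc⟩ := exists_eq_mul_left hl hr (Submodule.map e.toLinearMap I)
    (IsNoetherian.noetherian _) (g ∘ₗ (e.submoduleMap I).symm.toLinearMap)
  let m : Rᵐᵒᵖ →ₗ[Rᵐᵒᵖ] R :=
    { toFun := fun x => c * x.unop
      map_add' := by simp [mul_add]
      map_smul' := by simp [MulOpposite.smul_eq_mul_unop, mul_assoc] }
  refine ⟨m, fun x hx => ?_⟩
  have := hc (e.submoduleMap I ⟨x, hx⟩)
  rw [LinearMap.comp_apply, LinearEquiv.coe_coe, LinearEquiv.symm_apply_apply] at this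
  exact this.symm

/-- If injective left modules are projective and projective left modules are injective, then direct
sums of injective left modules are injective, so that `R` is left Noetherian by the argument of Bass
and Papp. -/
lemma isNoetherian_of_projective_iff_injective
    (hp : ∀ P : ModuleCat.{u} R, Projective P → Injective P)
    (hi : ∀ I : ModuleCat.{u} R, Injective I → Projective I) : IsNoetherian R R := by
  rw [← monotone_stabilizes_iff_noetherian]
  intro F
  let E (k : ℕ) := Injective.under (ModuleCat.of R (R ⧸ F k))
  let j (k : ℕ) : (R ⧸ F k) →ₗ[R] E k := (Injective.ι (ModuleCat.of R (R ⧸ F k))).hom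
  have hj (k) : Function.Injective (j k) := (ModuleCat.mono_iff_injective _).1
    (inferInstanceAs (Mono (Injective.ι (ModuleCat.of R (R ⧸ F k)))))
  have hE (k) : Module.Projective R (E k) := moduleCat_projective_iff.1 (hi _ inferInstance)
  let D : ModuleCat.{u} R := ModuleCat.of R (Π₀ k, E k)
  have hD : Module.Injective R (Π₀ k, E k) := moduleCat_injective_iff.1 (hp D
    (moduleCat_projective_iff.2 (inferInstanceAs (Module.Projective R (Π₀ k, E k)))))
  let I : Submodule R R := ⨆ k, F k
  have hI {x : R} (hx : x ∈ I) : ∃ k, x ∈ F k :=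
    (Submodule.mem_iSup_of_directed _ F.monotone.directed_le).1 hx
  obtain ⟨φ, hφ⟩ := LinearMap.exists_comp_eq_of_injective (R := R)
    (f := (DFinsupp.coeFnLinearMap R : (Π₀ k, E k) →ₗ[R] ∀ k, E k)) DFunLike.coe_injective
    (k := LinearMap.pi (fun k => j k ∘ₗ (F k).mkQ) ∘ₗ I.subtype) (by
      rintro ⟨x, hx⟩
      obtain ⟨n, hn⟩ := hI hx
      refine ⟨DFinsupp.mk (Finset.range n) fun k => j k ((F k).mkQ x), ?_⟩
      ext k
      by_cases hk : k < n
      · simp [hk]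
      · have : (Submodule.Quotient.mk x : R ⧸ F k) = 0 :=
          (Submodule.Quotient.mk_eq_zero _).2 (F.monotone (not_lt.1 hk) hn)
        simp [hk, this])
  obtain ⟨ψ, hψ⟩ := Module.Injective.extension_property R (Π₀ k, E k) _ _ I.subtype
    Subtype.val_injective φ
  classical
  obtain ⟨n, hn⟩ : ∃ n, ∀ k, n ≤ k → ψ 1 k = 0 := by
    refine ⟨(ψ 1).support.sup id + 1, fun k hk => ?_⟩
    by_contra h
    have := Finset.le_sup (f := id) (DFinsupp.mem_support_iff.2 h)
    dsimp at this
    omega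
  refine ⟨n, fun m hm => le_antisymm (F.monotone hm) fun x hx => ?_⟩
  have hx' : x ∈ I := Submodule.mem_iSup_of_mem m hx
  have h₁ : φ ⟨x, hx'⟩ n = j n (Submodule.Quotient.mk x) :=
    congrFun (LinearMap.congr_fun hφ ⟨x, hx'⟩) n
  have h₂ : ψ x = φ ⟨x, hx'⟩ := LinearMap.congr_fun hψ ⟨x, hx'⟩
  have h₃ : ψ x = x • ψ 1 := by rw [← map_smul, smul_eq_mul, mul_one]
  rw [← h₂, h₃, DFinsupp.smul_apply, hn n le_rfl, smul_zero] at h₁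
  rw [← Submodule.Quotient.mk_eq_zero]
  exact hj n (h₁.symm.trans (map_zero _).symm)

/-- A semiprimary ring whose projective left modules coincide with its injective left modules is
quasi-Frobenius. -/
lemma isQuasiFrobenius_of_projective_iff_injective [IsSemiprimaryRing R]
    (hp : ∀ P : ModuleCat.{u} R, Projective P → Injective P)
    (hi : ∀ I : ModuleCat.{u} R, Injective I → Projective I) : IsQuasiFrobenius R := by
  have h₁ := isNoetherian_of_projective_iff_injective hp hi
  have h₂ : IsArtinian R R := IsSemiprimaryRing.isNoetherian_iff_isArtinian.1 h₁
  have h₃ : Module.Injective R R := moduleCat_injective_iff.1 (hp (ModuleCat.of R R)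
    (moduleCat_projective_iff.2 (inferInstanceAs (Module.Projective R R))))
  have h₄ : IsNoetherian Rᵐᵒᵖ R := isNoetherian_op_of_injective
  exact ⟨h₁, h₄, h₃, injective_op (leftAnn_rightAnn hi) fun J => rightAnn_leftAnn⟩

end SelfInjective

/-! ### Modules over semiprimary rings -/

section Semiprimary

variable {R : Type u} [Ring R] {N : Ideal R} [N.IsTwoSided]

omit [N.IsTwoSided] in
lemma smul_eq_zero_of_isSimpleModule (hN : IsNilpotent N) {M : Type*} [AddCommGroup M]
    [Module R M] [IsSimpleModule R M] {r : R} (hr : r ∈ N) (x : M) : r • x = 0 := by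
  have h₀ : N • (⊤ : Submodule R M) = ⊥ := by
    refine (eq_bot_or_eq_top _).resolve_right fun h => ?_
    have hk (k : ℕ) : N ^ k • (⊤ : Submodule R M) = ⊤ := by
      induction k with
      | zero => rw [N.pow_zero, Ideal.one_eq_top, Submodule.top_smul]
      | succ k ih => rw [N.pow_succ, Submodule.mul_smul, h, ih]
    obtain ⟨k, hk'⟩ := hN
    have := hk k
    rw [hk', Submodule.zero_eq_bot, Submodule.bot_smul] at this
    exact bot_ne_top this
  exact (Submodule.mem_bot R).1 (h₀ ▸ Submodule.smul_mem_smul hr Submodule.mem_top)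

lemma isSemisimpleModule_of_isTorsionBySet (hss : IsSemisimpleRing (R ⧸ N)) {M : Type*}
    [AddCommGroup M] [Module R M] (h : Module.IsTorsionBySet R M N) : IsSemisimpleModule R M := by
  let _ := h.module
  exact (h.semilinearMap.isSemisimpleModule_iff_of_bijective Function.bijective_id).2 inferInstance

lemma isTorsionBySet_quotient : Module.IsTorsionBySet R (R ⧸ N) N := by
  rw [Module.isTorsionBySet_quotient_iff]
  exact fun x r hr => N.mul_mem_right x hr

lemma ring_jacobson_eq (hN : IsNilpotent N) (hss : IsSemisimpleRing (R ⧸ N)) :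
    Ring.jacobson R = N := by
  refine le_antisymm (fun r hr => ?_) ?_
  · have := isSemisimpleModule_of_isTorsionBySet hss (isTorsionBySet_quotient (N := N))
    have h := Module.mem_annihilator.1
      (IsSemisimpleModule.jacobson_le_annihilator R (R ⧸ N) hr) (Submodule.Quotient.mk 1)
    rwa [← Submodule.Quotient.mk_smul, smul_eq_mul, mul_one, Submodule.Quotient.mk_eq_zero] at h
  · rw [Ring.jacobson_eq_sInf_isMaximal]
    refine le_sInf fun m (hm : m.IsMaximal) r hr => ?_
    have : IsSimpleModule R (R ⧸ m) := isSimpleModule_iff_isCoatom.2 hm.out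
    have h := smul_eq_zero_of_isSimpleModule hN hr (Submodule.Quotient.mk 1 : R ⧸ m)
    rwa [← Submodule.Quotient.mk_smul, smul_eq_mul, mul_one,
      Submodule.Quotient.mk_eq_zero] at h

lemma isSemiprimaryRing (hN : IsNilpotent N) (hss : IsSemisimpleRing (R ⧸ N)) :
    IsSemiprimaryRing R := by
  have h := ring_jacobson_eq hN hss
  refine ⟨?_, h ▸ hN⟩
  exact (Ideal.quotEquivOfEq h.symm).isSemisimpleRing

/-- A property of modules over a semiprimary ring that holds for semisimple modules and is closed
under extensions holds for all modules. -/
lemma forall_of_isSemisimpleModule [IsSemiprimaryRing R] {p : ModuleCat.{u} R → Prop}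
    (hss : ∀ M : ModuleCat.{u} R, IsSemisimpleModule R M → p M)
    (hext : ∀ A B D : ModuleCat.{u} R, Ses A B D → p A → p D → p B) (M : ModuleCat.{u} R) :
    p M := by
  refine IsSemiprimaryRing.induction ℤ R M (P := fun M => p (ModuleCat.of R M))
    (fun M _ _ _ _ hM _ => hss _ hM) (fun M _ _ _ _ => ?_)
  intro K hK hMK
  refine hext (ModuleCat.of R K) _ (ModuleCat.of R (M ⧸ K)) (.of_linearMap (f := K.subtype)
    (g := K.mkQ) Subtype.val_injective ?_ K.mkQ_surjective) hK hMK
  intro x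
  simp

/-- Over a semiprimary ring, simple modules are direct summands of `R ⧸ N`. -/
lemma exists_retract_quotient (hN : IsNilpotent N) (hss : IsSemisimpleRing (R ⧸ N))
    (C : ModuleCat.{u} R) [IsSimpleModule R C] :
    Nonempty (Retract C (ModuleCat.of R (R ⧸ N))) := by
  have := isSemisimpleModule_of_isTorsionBySet hss (isTorsionBySet_quotient (N := N))
  have := IsSimpleModule.nontrivial R C
  obtain ⟨c, hc⟩ := exists_ne (0 : C)
  have hle : N ≤ LinearMap.ker (LinearMap.toSpanSingleton R C c) := fun r hr =>
    smul_eq_zero_of_isSimpleModule hN hr c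
  have hsurj : Function.Surjective (Submodule.liftQ N _ hle) := by
    rw [← LinearMap.range_eq_top, Submodule.range_liftQ, LinearMap.range_eq_top]
    exact IsSimpleModule.toSpanSingleton_surjective R hc
  obtain ⟨s, hs⟩ := IsSemisimpleModule.lifting_property (Submodule.liftQ N _ hle) hsurj
    LinearMap.id
  exact ⟨{ i := ModuleCat.ofHom s, r := ModuleCat.ofHom (Submodule.liftQ N _ hle),
           retract := by ext x; exact LinearMap.congr_fun hs x }⟩

lemma gpDim_of_simple [IsSemiprimaryRing R] {n : ℕ}
    (h : ∀ C : ModuleCat.{u} R, IsSimpleModule R C → GPDim n C) (M : ModuleCat.{u} R) :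
    GPDim n M := by
  refine forall_of_isSemisimpleModule (fun M hM => ?_) (fun _ _ _ hs hA hD => .extension hs hA hD) M
  classical
  obtain ⟨s, e, -, hs⟩ := IsSemisimpleModule.exists_linearEquiv_dfinsupp R M
  let Z : s → ModuleCat.{u} R := fun m => ModuleCat.of R m.1
  have hZ : GPDim n (∐ Z) := GPDim.sigma fun m => h _ (hs m)
  exact (hZ.of_iso (ModuleCat.coprodIsoDirectSum Z)).of_iso
    (LinearEquiv.toModuleIso (X₁ := DirectSum s fun m => m.1) e.symm)

lemma gpDim_op_of_simple (hN : IsNilpotent N) (hss : IsSemisimpleRing (R ⧸ N)) {n : ℕ}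
    (h : ∀ C : ModuleCat.{u} R, IsSimpleModule R C → GPDim n (op C)) (M : ModuleCat.{u} R) :
    GPDim n (op M) := by
  have := isSemiprimaryRing hN hss
  refine forall_of_isSemisimpleModule (p := fun M => GPDim n (op M)) (fun M hM => ?_)
    (fun _ _ _ hs hA hD => .extension hs.op hD hA) M
  classical
  obtain ⟨s, e, -, hs⟩ := IsSemisimpleModule.exists_linearEquiv_dfinsupp R M
  let Z : s → ModuleCat.{u} R := fun m => ModuleCat.of R m.1
  have hZ : GPDim n (∐ fun m => op (Z m)) := GPDim.sigma fun m => h _ (hs m)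
  have hZ' : GPDim n (op (ModuleCat.of R (∀ m, Z m))) :=
    (hZ.of_iso (opProductIsoCoproduct Z).symm).of_iso (ModuleCat.piIsoPi Z).symm.op
  -- the direct sum of the simple summands is a retract of their product, which is semisimple
  have : IsSemisimpleModule R (∀ m, Z m) := by
    refine isSemisimpleModule_of_isTorsionBySet hss fun x r => ?_
    ext1 m
    have := hs m
    exact smul_eq_zero_of_isSimpleModule hN r.2 (M := m.1) (x m)
  let f : M →ₗ[R] ∀ m, Z m :=
    (DFinsupp.coeFnLinearMap R : (Π₀ m : s, m.1) →ₗ[R] ∀ m : s, m.1) ∘ₗ e.toLinearMap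
  obtain ⟨g, hg⟩ := IsSemisimpleModule.extension_property f
    (DFunLike.coe_injective.comp e.injective) LinearMap.id
  let r : Retract M (ModuleCat.of R (∀ m, Z m)) :=
    { i := ModuleCat.ofHom f, r := ModuleCat.ofHom g,
      retract := by ext x; exact LinearMap.congr_fun hg x }
  exact hZ'.retract r.op

end Semiprimary

/-! ### The global dimension formulas -/

theorem theorem1 {R : Type u} [Ring R] (N : Ideal R) [N.IsTwoSided] (hN : IsNilpotent N)
    (hss : IsSemisimpleRing (R ⧸ N)) :
    leftGgldim R = (⨆ M : ModuleCat.{u} R, Gid R M) ∧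
    leftGgldim R = Gpd R (R ⧸ N) ∧
    leftGgldim R = Gid R (R ⧸ N) ∧
    leftGgldim R = (⨆ (C : ModuleCat.{u} R) (_ : IsSimpleModule R C), Gpd R C) ∧
    leftGgldim R = (⨆ (C : ModuleCat.{u} R) (_ : IsSimpleModule R C), Gid R C) ∧
    (¬ IsQuasiFrobenius R → leftGgldim R = 1 + Gpd R N) := by
  have := isSemiprimaryRing hN hss
  -- dimensions are compared through their natural number upper bounds, which determine them
  have ext {a b : ℕ∞} (h : ∀ n : ℕ, a ≤ n ↔ b ≤ n) : a = b :=
    eq_of_forall_ge_iff fun c => by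
      induction c using ENat.recTopCoe with
      | top => simp
      | coe n => exact h n
  have hall (n : ℕ) : leftGgldim R ≤ n ↔ ∀ M : ModuleCat.{u} R, GPDim n M := by
    rw [leftGgldim, iSup_le_iff]
    exact forall_congr' fun M => gpd_le_iff
  have hop (n : ℕ) : leftGgldim R ≤ n ↔ ∀ M : ModuleCat.{u} R, GPDim n (op M) := by
    rw [hall, ← forall_gpDim_op_iff]
    exact ⟨fun h M => h (op M), fun h M => h M.unop⟩
  have hquot (n : ℕ) : leftGgldim R ≤ n ↔ GPDim n (ModuleCat.of R (R ⧸ N)) := by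
    rw [hall]
    refine ⟨fun h => h _, fun h => gpDim_of_simple fun C hC => ?_⟩
    obtain ⟨r⟩ := exists_retract_quotient hN hss C
    exact h.retract r
  refine ⟨ext fun n => ?_, ext fun n => ?_, ext fun n => ?_, ext fun n => ?_, ext fun n => ?_,
    fun hQF => ext fun n => ?_⟩
  · rw [hop, iSup_le_iff]
    exact forall_congr' fun M => gid_le_iff.symm
  · rw [hquot, gpd_le_iff]
  · rw [hop, gid_le_iff]
    refine ⟨fun h => h _, fun h => gpDim_op_of_simple hN hss fun C hC => ?_⟩
    obtain ⟨r⟩ := exists_retract_quotient hN hss C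
    exact h.retract r.op
  · rw [hall, iSup₂_le_iff]
    exact ⟨fun h C _ => gpd_le_iff.2 (h C), fun h =>
      gpDim_of_simple fun C hC => gpd_le_iff.1 (h C hC)⟩
  · rw [hop, iSup₂_le_iff]
    exact ⟨fun h C _ => gid_le_iff.2 (h C), fun h =>
      gpDim_op_of_simple hN hss fun C hC => gid_le_iff.1 (h C hC)⟩
  · have hs : Ses (ModuleCat.of R N) (ModuleCat.of R R) (ModuleCat.of R (R ⧸ N)) :=
      .of_linearMap (f := N.subtype) (g := N.mkQ) Subtype.val_injective (fun x =>
        (Submodule.Quotient.mk_eq_zero N).trans (by simp)) N.mkQ_surjective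
    have hR : Projective (ModuleCat.of R R) :=
      moduleCat_projective_iff.2 (inferInstanceAs (Module.Projective R R))
    cases n with
    | zero =>
      -- dimension zero would force projective and injective modules to coincide
      refine ⟨fun h => absurd ?_ hQF, fun h => ?_⟩
      · obtain ⟨h₁, h₂⟩ := forall_gpDim_iff.1 ((hall 0).1 h)
        exact isQuasiFrobenius_of_projective_iff_injective
          (fun P hP => injective_iff_hasInjectiveDimensionLT_one.2 (h₁ P hP))
          (fun I hI => projective_iff_hasProjectiveDimensionLT_one.2 (h₂ I hI))
      · have : (1 : ℕ∞) ≤ 0 := le_self_add.trans h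
        simp at this
    | succ n =>
      rw [hquot, Nat.cast_add, Nat.cast_one, add_comm (1 : ℕ∞),
        ENat.add_le_add_iff_right ENat.one_ne_top, gpd_le_iff]
      exact ⟨fun h => h.syzygy hs hR, fun h => ⟨_, _, hR, hs, h⟩⟩
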